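/- Let $\mathcal X$ be a Polish space, $\Omega=C([0,1];\mathcal X)$ with the topology of uniform convergence and its Borel $\sigma$-field, and $X_t(\omega)=\omega(t)$. For a (nonnegative) Borel measure $Q$ on $\Omega$ write $Q_{t_1,\dots,t_k}$ for the law of $(X_{t_1},\dots,X_{t_k})$ under $Q$. Call $Q$ \emph{conditionable} if $Q_t$ is $\sigma$-finite for every $t\in[0,1]$, and \emph{reciprocal} if it is conditionable and, for all $0<s<u<1$, all $A\in\sigma(X_t: t\in[0,s]\cup[u,1])$ and all $B\in\sigma(X_t: t\in[s,u])$, $$Q(A\cap B\mid X_s,X_u)=Q(A\mid X_s,X_u)\,Q(B\mid X_s,X_u)\qquad Q\text{-a.e.}$$ A reciprocal measure $R$ is \emph{irreducible} if, for all $0\le s<u<t\le 1$, the measures $R_{s,u,t}$ and $R_s\otimes R_u\otimes R_t$ are mutually absolutely continuous. For a conditionable measure $R$ and a Borel probability measure $P$ on $\Omega$, the relative entropy is defined by $$H(P|R)=H(P|R_W)-\int W\,dP-\log z_W\in(-\infty,+\infty],$$ whenever there is a measurable $W:\Omega\to[0,\infty)$ with $z_W=\int e^{-W}dR<\infty$ and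 $\int W\,dP<\infty$, where $R_W=z_W^{-1}e^{-W}R$ and $H(P|R_W)$ is the usual relative entropy of probability measures (the value does not depend on $W$; for $R=0$ we set $H(P|R)=+\infty$). Let $\mathcal T\subset[0,1]$, let $\mu_t$ ($t\in\mathcal T$) be probability measures on $\mathcal X$ and $\pi$ a probability measure on $\mathcal X\times\mathcal X$. The Brödinger problem is to minimize $H(Q|R)$ among the Borel probability measures $Q$ on $\Omega$ for which it is defined and which satisfy $Q_t=\mu_t$ for all $t\in\mathcal T$ and $Q_{0,1}=\pi$. A solution is a minimizer with finite relative entropy. \textbf{Theorem.} Suppose that $R$ is reciprocal and that the Brödinger problem has a solution $P$. Then $P$ is reciprocal. If in addition $R$ is irreducible and $\mathcal T=\{t_1,\dots,t_K\}$ is finite, then $P\ll R$ and there exist measurable functions $\eta:\mathcal X\times\mathcal X\to[-\infty,+\infty)$ and $f_1,\dots,f_K:\mathcal X\to[-\infty,+\infty)$ such that $$\frac{dP}{dR}=\exp\Big(\eta(X_0,X_1)+\sum_{i=1}^K f_i(X_{t_i})\Big)\qquad R\text{-a.e.}$$ -/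

import Mathlib

open MeasureTheory Set
open scoped unitInterval ENNReal

namespace Brodinger

/-! Path measures are measures on the space `C(I, 𝓧)` of continuous curves from `I = [0, 1]` to
`𝓧`, with the topology of uniform convergence (the compact-open topology) and its Borel
`σ`-field. The canonical process is `X_t ω = ω t`. -/

section PathSpace

variable {𝓧 : Type*} [TopologicalSpace 𝓧] [MeasurableSpace 𝓧]

/-- The `σ`-field `σ(X_t ; t ∈ S)` on the path space. -/
@[reducible] def pathSigma (S : Set I) : MeasurableSpace C(I, 𝓧) :=
  ⨆ t ∈ S, MeasurableSpace.comap (fun ω : C(I, 𝓧) => ω t) inferInstance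

variable [MeasurableSpace C(I, 𝓧)]

/-- The law `Q_t` of `X_t` under `Q`. -/
noncomputable def law (Q : Measure C(I, 𝓧)) (t : I) : Measure 𝓧 :=
  Q.map (fun ω => ω t)

/-- The law `Q_{s,t}` of `(X_s, X_t)` under `Q`. -/
noncomputable def law₂ (Q : Measure C(I, 𝓧)) (s t : I) : Measure (𝓧 × 𝓧) :=
  Q.map (fun ω => (ω s, ω t))

/-- The law `Q_{s,u,t}` of `(X_s, X_u, X_t)` under `Q`. -/
noncomputable def law₃ (Q : Measure C(I, 𝓧)) (s u t : I) : Measure (𝓧 × 𝓧 × 𝓧) :=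
  Q.map (fun ω => (ω s, ω u, ω t))

/-- A path measure is conditionable if all its time marginals are `σ`-finite. -/
def IsConditionable (Q : Measure C(I, 𝓧)) : Prop :=
  ∀ t : I, SigmaFinite (law Q t)

/-- Every `σ(X_t ; t ∈ S)` is a sub-`σ`-field of the Borel `σ`-field. -/
theorem pathSigma_le [BorelSpace 𝓧] [BorelSpace C(I, 𝓧)] (S : Set I) :
    pathSigma S ≤ (inferInstance : MeasurableSpace C(I, 𝓧)) := by
  refine iSup₂_le fun t _ => ?_
  have h : Measurable fun ω : C(I, 𝓧) => ω t := (continuous_eval_const t).measurable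
  exact h.comap_le

/-- A conditionable measure is `σ`-finite on `σ(X_t ; t ∈ S)` for nonempty `S`, so that conditional
probabilities given this `σ`-field are well defined. -/
theorem IsConditionable.sigmaFinite_trim [BorelSpace 𝓧] [BorelSpace C(I, 𝓧)]
    {Q : Measure C(I, 𝓧)} (hQ : IsConditionable Q) {S : Set I} (hS : S.Nonempty) :
    SigmaFinite (Q.trim (pathSigma_le S)) := by
  obtain ⟨t, ht⟩ := hS
  have hX : Measurable[pathSigma S] fun ω : C(I, 𝓧) => ω t :=
    Measurable.of_comap_le (le_iSup₂ (f := fun (t : I) (_ : t ∈ S) =>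
      MeasurableSpace.comap (fun ω : C(I, 𝓧) => ω t) inferInstance) t ht)
  have := hQ t
  have h : @Measure.map _ _ (pathSigma S) _ (fun ω : C(I, 𝓧) => ω t) (Q.trim (pathSigma_le S))
      = law Q t := by
    ext B hB
    rw [@Measure.map_apply _ _ (pathSigma S) _ _ _ hX _ hB, trim_measurableSet_eq _ (hX hB), law,
      Measure.map_apply (hX.mono (pathSigma_le S) le_rfl) hB]
  exact @SigmaFinite.of_map _ _ (pathSigma S) _ (Q.trim (pathSigma_le S)) _
    (@Measurable.aemeasurable _ _ (pathSigma S) _ _ _ hX) (h ▸ this)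

/-- The conditional probability `Q(A | 𝒢)` of an event given a sub-`σ`-field on which `Q` is
`σ`-finite: the `𝒢`-measurable function whose integral over each `C ∈ 𝒢` is `Q(A ∩ C)`. The
`ℝ≥0∞`-valued conditional expectation is used because `A` may have infinite `Q`-measure. -/
noncomputable def condProb (Q : Measure C(I, 𝓧)) (𝒢 : MeasurableSpace C(I, 𝓧))
    (A : Set C(I, 𝓧)) : C(I, 𝓧) → ℝ≥0∞ :=
  condLExp 𝒢 Q (A.indicator 1)

/-- A path measure is reciprocal if it is conditionable and if, for all `0 < s < u < 1`, the events
outside `(s, u)` and the events inside `[s, u]` are conditionally independent given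
`(X_s, X_u)`. -/
def IsReciprocal (Q : Measure C(I, 𝓧)) : Prop :=
  IsConditionable Q ∧
    ∀ s u : I, 0 < s → s < u → u < 1 →
      ∀ A B : Set C(I, 𝓧),
        MeasurableSet[pathSigma (Iic s ∪ Ici u)] A →
        MeasurableSet[pathSigma (Icc s u)] B →
        condProb Q (pathSigma {s, u}) (A ∩ B) =ᵐ[Q]
          condProb Q (pathSigma {s, u}) A * condProb Q (pathSigma {s, u}) B

/-- Irreducibility: `R_{s,u,t}` and `R_s ⊗ R_u ⊗ R_t` are equivalent for all
`0 ≤ s < u < t ≤ 1`. -/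
def IsIrreducible (R : Measure C(I, 𝓧)) : Prop :=
  ∀ s u t : I, s < u → u < t →
    (law R s).prod ((law R u).prod (law R t)) ≪ law₃ R s u t ∧
      law₃ R s u t ≪ (law R s).prod ((law R u).prod (law R t))

end PathSpace

section Entropy

variable {Ω : Type*} [MeasurableSpace Ω]

/-- `W ≥ 0` is a measurable function with `z_W = ∫ e^{-W} dR < ∞` and `∫ W dP < ∞`. -/
structure IsWeight (R P : Measure Ω) (W : Ω → ℝ) : Prop where
  measurable : Measurable W
  nonneg : ∀ ω, 0 ≤ W ω
  integrable_exp : Integrable (fun ω => Real.exp (-W ω)) R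
  integrable : Integrable W P

/-- The expression `H(P|R_W) - ∫ W dP - log z_W`, where `z_W = ∫ e^{-W} dR` and
`R_W = z_W⁻¹ e^{-W} R`, which is `R.tilted (-W)`. For probability measures, `klDiv` is the usual
relative entropy `∫ log (dP/dR_W) dP`, equal to `∞` if `P` is not dominated by `R_W`. -/
noncomputable def relEntropyVia (R P : Measure Ω) (W : Ω → ℝ) : EReal :=
  (InformationTheory.klDiv P (R.tilted fun ω => -W ω) : EReal)
    - ((∫ ω, W ω ∂P : ℝ) : EReal) - ((Real.log (∫ ω, Real.exp (-W ω) ∂ R) : ℝ) : EReal)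

/-- The relative entropy `H(P|R)` is defined and equal to `h`. The value does not depend on the
weight, see `relEntropyVia_congr`. -/
def IsRelEntropy (R P : Measure Ω) (h : EReal) : Prop :=
  ∃ W : Ω → ℝ, IsWeight R P W ∧ h = relEntropyVia R P W

open Classical in
theorem relEntropyVia_eq {R P : Measure Ω} [SigmaFinite R] [IsProbabilityMeasure P] {W : Ω → ℝ}
    (hW : IsWeight R P W) :
    relEntropyVia R P W =
      if P ≪ R ∧ Integrable (llr P R) P then ((∫ ω, llr P R ω ∂P : ℝ) : EReal) else ⊤ := by
  have hf : Integrable (fun ω => -W ω) P := hW.integrable.neg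
  have hac : P ≪ R.tilted (fun ω => -W ω) ↔ P ≪ R :=
    ⟨fun h => h.trans (tilted_absolutelyContinuous R _),
      fun h => h.trans (absolutelyContinuous_tilted hW.integrable_exp)⟩
  split_ifs with h
  · obtain ⟨h1, h2⟩ := h
    have hR : NeZero R := ⟨fun h0 => by
      rw [h0, Measure.absolutelyContinuous_zero_iff] at h1
      exact IsProbabilityMeasure.ne_zero P h1⟩
    have := isProbabilityMeasure_tilted hW.integrable_exp
    have h3 := integrable_llr_tilted_right h1 hf h2 hW.integrable_exp
    have h4 := InformationTheory.klDiv_ne_top (hac.2 h1) h3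
    have h5 := InformationTheory.toReal_klDiv_of_measure_eq (hac.2 h1) (by simp)
    rw [integral_llr_tilted_right h1 hf hW.integrable_exp h2, integral_neg] at h5
    rw [relEntropyVia, ← EReal.coe_toReal (x := (InformationTheory.klDiv P _ : EReal))
      (by simpa using h4) (by simp), EReal.toReal_coe_ennreal, h5]
    norm_cast
    ring
  · have : InformationTheory.klDiv P (R.tilted fun ω => -W ω) = ∞ := by
      rw [InformationTheory.klDiv_eq_top_iff, hac]
      intro h1 h2
      refine h ⟨h1, ?_⟩
      rw [integrable_congr (llr_tilted_right h1 hW.integrable_exp)] at h2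
      have h3 := h2.sub (hf.neg.add
        (integrable_const (Real.log (∫ z, Real.exp (-W z) ∂ R))))
      refine h3.congr (Filter.Eventually.of_forall fun x => ?_)
      simp
    simp [relEntropyVia, this]

theorem relEntropyVia_congr {R P : Measure Ω} [SigmaFinite R] [IsProbabilityMeasure P]
    {W W' : Ω → ℝ} (hW : IsWeight R P W) (hW' : IsWeight R P W') :
    relEntropyVia R P W = relEntropyVia R P W' := by
  rw [relEntropyVia_eq hW, relEntropyVia_eq hW']

end Entropy

section Problem

variable {𝓧 : Type*} [TopologicalSpace 𝓧] [MeasurableSpace 𝓧] [MeasurableSpace C(I, 𝓧)]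

/-- The competitors of the Brödinger problem: path probability measures `Q` with `Q_t = μ_t` for
all `t ∈ 𝒯` and `Q_{0,1} = π`. -/
structure IsCompetitor (𝒯 : Set I) (μ : I → Measure 𝓧) (π : Measure (𝓧 × 𝓧))
    (Q : Measure C(I, 𝓧)) : Prop where
  isProbabilityMeasure : IsProbabilityMeasure Q
  marginal : ∀ t ∈ 𝒯, law Q t = μ t
  endpoint : law₂ Q 0 1 = π

/-- `P` is a solution of the Brödinger problem: a competitor of finite relative entropy with respect
to `R` that minimizes the relative entropy among all competitors for which it is defined. -/
def IsSolution (R : Measure C(I, 𝓧)) (𝒯 : Set I) (μ : I → Measure 𝓧) (π : Measure (𝓧 × 𝓧))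
    (P : Measure C(I, 𝓧)) : Prop :=
  IsCompetitor 𝒯 μ π P ∧
    ∃ h : EReal, IsRelEntropy R P h ∧ h < ⊤ ∧
      ∀ (Q : Measure C(I, 𝓧)) (h' : EReal),
        IsCompetitor 𝒯 μ π Q → IsRelEntropy R Q h' → h ≤ h'

end Problem

end Brodinger

/-!
A solution `P` has a density `ρ` with respect to `R` that minimizes `∫ ρ log ρ dR` under the
constraints (`IsSolution.isMinDensity`); the weights in the definition of the relative entropy only
matter to see that all densities with `ρ log ρ` integrable compete.

*Reciprocity.* Let `𝒜` and `ℬ` be conditionally independent given `𝒢` under `R`, and let `a`, `b`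
and `g` be the densities of the restrictions of `P` to these `σ`-fields. The measure with density
`a b / g` agrees with `P` on `𝒜` and on `ℬ`. If the constraints only see these restrictions, then
it is a competitor, and the entropy gained by passing to it is the relative entropy of `ρ` with
respect to `a b / g`; so `ρ = a b / g` (`IsMinDensity.eq_mul_div`), and such a product density
preserves conditional independence (`CondIndepGiven.of_density`). Every constraint on a single time
concerns one of the two blocks, outside and inside of `[s, u]`, and the constraint on the endpoints
concerns the outer one. As `R` may be infinite, the comparison of entropies is made on sets of
finite measure in `𝒢`.

*The density.* Let `Y` consist of the pair of endpoints and of the states at the constrained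
interior times. The same product formula with `𝒜 = ℬ = 𝒢 = σ(Y)` shows that `ρ` is a function of `Y`
(`IsMinDensity.exists_eq_comp`), and the problem becomes one with prescribed marginals
on a finite product. There, irreducibility and reciprocity make the law of `Y` under `R` equivalent
to the product of its marginals (`IsIrreducible.map_constraintMap_equiv`): the interior times are
added one by one, the state at `t` being linked to the other ones only through the states at
times `s < t < u` close to `t`.

It remains to see that `ρ` is a product of functions of one coordinate. Closedness of sums of such
functions is a delicate matter, and is avoided by an argument of cyclical monotonicity. Take as many
independent rows of law `P` as there are coordinates, and let new rows be formed by permuting each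
column of this array in such a way that each new row takes its coordinates from distinct rows.
Moving mass from the old rows to the new ones does not change the marginals, so the first variation
of the entropy (`IsMinDensity.integral_log_le`) gives `∏ ρ(old) ≤ ∏ ρ(new)` almost everywhere
(`IsMinDensity.prod_le_prod_shuffle`). In particular `ρ > 0` on the product of the marginals
of `P`. The inverse permutations give the converse inequality, and hence an equality. For
cyclic shifts each new row contains exactly one coordinate of the first old row; when the other old
rows are fixed, the equality expresses `ρ` as a product (`IsMinDensity.exists_eq_prod`).
-/

namespace Brodinger

/-! ### Conditional independence under infinite measures -/

section CondIndep

variable {Ω : Type*} {𝒢 𝒜 ℬ m m0 : MeasurableSpace Ω} {R P Q : Measure[m0] Ω}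

theorem trim_eq_of_forall_eq (hm : m ≤ m0) (h : ∀ s, MeasurableSet[m] s → P s = Q s) :
    P.trim hm = Q.trim hm := by
  refine @Measure.ext _ m _ _ fun s hs => ?_
  rw [trim_measurableSet_eq hm hs, trim_measurableSet_eq hm hs, h s hs]

theorem lintegral_eq_of_forall_eq (hm : m ≤ m0) (h : ∀ s, MeasurableSet[m] s → P s = Q s)
    {f : Ω → ℝ≥0∞} (hf : Measurable[m] f) : ∫⁻ ω, f ω ∂P = ∫⁻ ω, f ω ∂Q := by
  rw [← lintegral_trim hm hf, ← lintegral_trim hm hf, trim_eq_of_forall_eq hm h]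

/-- The pull-out property of the conditional expectation, in integrated form. -/
theorem lintegral_mul_condLExp (hm : m ≤ m0) [SigmaFinite (R.trim hm)] {f X : Ω → ℝ≥0∞}
    (hf : Measurable[m] f) (hX : Measurable X) :
    ∫⁻ ω, f ω * condLExp m R X ω ∂ R = ∫⁻ ω, f ω * X ω ∂ R := by
  have h := lintegral_eq_of_forall_eq (P := R.withDensity (condLExp m R X))
    (Q := R.withDensity X) hm (fun s hs => by
      rw [withDensity_apply _ (hm s hs), withDensity_apply _ (hm s hs),
        setLIntegral_condLExp hm R X hs]) hf
  rw [lintegral_withDensity_eq_lintegral_mul _ (measurable_condLExp' m R X) (hf.mono hm le_rfl),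
    lintegral_withDensity_eq_lintegral_mul _ hX (hf.mono hm le_rfl)] at h
  simpa [mul_comm] using h

/-- The `σ`-fields `𝒜` and `ℬ` are conditionally independent given `𝒢` under the measure `R`, which
may be infinite. The `ℝ≥0∞`-valued conditional expectation is used, as for `condProb`. -/
def CondIndepGiven (𝒢 𝒜 ℬ : MeasurableSpace Ω) (R : Measure[m0] Ω) : Prop :=
  ∀ A B : Set Ω, MeasurableSet[𝒜] A → MeasurableSet[ℬ] B →
    condLExp 𝒢 R ((A ∩ B).indicator 1) =ᵐ[R]
      condLExp 𝒢 R (A.indicator 1) * condLExp 𝒢 R (B.indicator 1)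

/-- Given itself, a `σ`-field is conditionally independent of itself: the indicators of its events
are their own conditional probabilities. -/
theorem condIndepGiven_self (h𝒢 : 𝒢 ≤ m0) [SigmaFinite (R.trim h𝒢)] :
    CondIndepGiven 𝒢 𝒢 𝒢 R := by
  intro A B hA hB
  have key : ∀ s, MeasurableSet[𝒢] s →
      condLExp 𝒢 R (s.indicator 1) = (s.indicator 1 : Ω → ℝ≥0∞) := fun s hs =>
    condLExp_eq_self h𝒢 R (Measurable.indicator (@measurable_const _ _ _ 𝒢 1) hs)
  rw [key _ (hA.inter hB), key _ hA, key _ hB, Set.inter_indicator_one]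

/-- Conditional independence for functions: given a function `h` of the second block, integrating
against the first block only sees the conditional expectation of `h`. -/
theorem CondIndepGiven.lintegral_mul (hci : CondIndepGiven 𝒢 𝒜 ℬ R) (h𝒢 : 𝒢 ≤ m0)
    [SigmaFinite (R.trim h𝒢)] (h𝒜 : 𝒜 ≤ m0) (hℬ : ℬ ≤ m0) {f h : Ω → ℝ≥0∞}
    (hf : Measurable[𝒜] f) (hh : Measurable[ℬ] h) :
    ∫⁻ ω, f ω * h ω ∂ R = ∫⁻ ω, f ω * condLExp 𝒢 R h ω ∂ R := by
  have hf0 : Measurable f := hf.mono h𝒜 le_rfl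
  have hh0 : Measurable h := hh.mono hℬ le_rfl
  have ind : ∀ s, MeasurableSet s → Measurable (s.indicator (1 : Ω → ℝ≥0∞)) := fun s hs =>
    measurable_const.indicator hs
  have set_set : ∀ A B, MeasurableSet[𝒜] A → MeasurableSet[ℬ] B →
      R (A ∩ B) = ∫⁻ ω in A, condLExp 𝒢 R (B.indicator 1) ω ∂ R := by
    intro A B hA hB
    have hA0 := h𝒜 _ hA
    have hB0 := hℬ _ hB
    calc R (A ∩ B) = ∫⁻ ω, (A ∩ B).indicator 1 ω ∂ R := by
          rw [lintegral_indicator_one (hA0.inter hB0)]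
      _ = ∫⁻ ω, condLExp 𝒢 R ((A ∩ B).indicator 1) ω ∂ R := (lintegral_condLExp h𝒢 R _).symm
      _ = ∫⁻ ω, condLExp 𝒢 R (B.indicator 1) ω * condLExp 𝒢 R (A.indicator 1) ω ∂ R := by
          refine lintegral_congr_ae ?_
          filter_upwards [hci A B hA hB] with ω hω
          rw [hω, Pi.mul_apply, mul_comm]
      _ = ∫⁻ ω, condLExp 𝒢 R (B.indicator 1) ω * A.indicator 1 ω ∂ R :=
          lintegral_mul_condLExp h𝒢 (measurable_condLExp _ _ _) (ind A hA0)
      _ = ∫⁻ ω in A, condLExp 𝒢 R (B.indicator 1) ω ∂ R := by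
          rw [← lintegral_indicator hA0]
          refine lintegral_congr fun ω => ?_
          by_cases hω : ω ∈ A <;> simp [hω]
  have fun_set : ∀ B, MeasurableSet[ℬ] B →
      ∫⁻ ω in B, f ω ∂ R = ∫⁻ ω in B, condLExp 𝒢 R f ω ∂ R := by
    intro B hB
    have hB0 := hℬ _ hB
    calc ∫⁻ ω in B, f ω ∂ R
        = ∫⁻ ω, f ω ∂ (R.withDensity (condLExp 𝒢 R (B.indicator 1))) := by
          refine lintegral_eq_of_forall_eq h𝒜 (fun A hA => ?_) hf
          rw [Measure.restrict_apply (h𝒜 _ hA), withDensity_apply _ (h𝒜 _ hA), set_set A B hA hB]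
      _ = ∫⁻ ω, condLExp 𝒢 R (B.indicator 1) ω * f ω ∂ R := by
          rw [lintegral_withDensity_eq_lintegral_mul _ (measurable_condLExp' _ _ _) hf0]; rfl
      _ = ∫⁻ ω, condLExp 𝒢 R (B.indicator 1) ω * condLExp 𝒢 R f ω ∂ R :=
          (lintegral_mul_condLExp h𝒢 (measurable_condLExp _ _ _) hf0).symm
      _ = ∫⁻ ω, condLExp 𝒢 R f ω * condLExp 𝒢 R (B.indicator 1) ω ∂ R := by simp_rw [mul_comm]
      _ = ∫⁻ ω, condLExp 𝒢 R f ω * B.indicator 1 ω ∂ R :=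
          lintegral_mul_condLExp h𝒢 (measurable_condLExp _ _ _) (ind B hB0)
      _ = ∫⁻ ω in B, condLExp 𝒢 R f ω ∂ R := by
          rw [← lintegral_indicator hB0]
          refine lintegral_congr fun ω => ?_
          by_cases hω : ω ∈ B <;> simp [hω]
  have fun_fun : ∫⁻ ω, h ω ∂ (R.withDensity f) = ∫⁻ ω, h ω ∂ (R.withDensity (condLExp 𝒢 R f)) := by
    refine lintegral_eq_of_forall_eq hℬ (fun B hB => ?_) hh
    rw [withDensity_apply _ (hℬ _ hB), withDensity_apply _ (hℬ _ hB), fun_set B hB]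
  rw [lintegral_withDensity_eq_lintegral_mul _ hf0 hh0,
    lintegral_withDensity_eq_lintegral_mul _ (measurable_condLExp' _ _ _) hh0] at fun_fun
  calc ∫⁻ ω, f ω * h ω ∂ R = ∫⁻ ω, condLExp 𝒢 R f ω * h ω ∂ R := fun_fun
    _ = ∫⁻ ω, condLExp 𝒢 R f ω * condLExp 𝒢 R h ω ∂ R :=
        (lintegral_mul_condLExp h𝒢 (measurable_condLExp _ _ _) hh0).symm
    _ = ∫⁻ ω, condLExp 𝒢 R h ω * condLExp 𝒢 R f ω ∂ R := by simp_rw [mul_comm]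
    _ = ∫⁻ ω, condLExp 𝒢 R h ω * f ω ∂ R :=
        lintegral_mul_condLExp h𝒢 (measurable_condLExp _ _ _) hf0
    _ = ∫⁻ ω, f ω * condLExp 𝒢 R h ω ∂ R := by simp_rw [mul_comm]

end CondIndep

/-! ### Densities of minimal entropy -/

section MinDensity

/-- The integrand of the relative entropy of two densities of equal mass is nonnegative. The value
`log 0 = 0` does no harm, because `x = 0` where `y = 0`. -/
theorem mul_log_sub_nonneg {x y : ℝ} (hx : 0 ≤ x) (hy : 0 ≤ y) (h : y = 0 → x = 0) :
    0 ≤ x * Real.log x - x * Real.log y - x + y := by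
  rcases hx.eq_or_lt with rfl | hx
  · simpa using hy
  have hy : 0 < y := hy.lt_of_ne fun h0 => hx.ne' (h h0.symm)
  have h1 := Real.log_le_sub_one_of_pos (div_pos hy hx)
  rw [Real.log_div hy.ne' hx.ne'] at h1
  have h2 := mul_le_mul_of_nonneg_left h1 hx.le
  have h3 : x * (y / x - 1) = y - x := by field_simp
  linarith [h3 ▸ h2]

theorem eq_of_mul_log_sub_eq_zero {x y : ℝ} (hx : 0 ≤ x) (hy : 0 ≤ y) (h : y = 0 → x = 0)
    (h0 : x * Real.log x - x * Real.log y - x + y = 0) : x = y := by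
  rcases hx.eq_or_lt with rfl | hx
  · simpa using h0.symm
  have hy : 0 < y := hy.lt_of_ne fun h0 => hx.ne' (h h0.symm)
  by_contra hne
  have h1 := Real.log_lt_sub_one_of_pos (div_pos hy hx)
    (fun h => hne ((div_eq_one_iff_eq hx.ne').1 h).symm)
  rw [Real.log_div hy.ne' hx.ne'] at h1
  have h2 := mul_lt_mul_of_pos_left h1 hx
  have h3 : x * (y / x - 1) = y - x := by field_simp
  linarith [h3 ▸ h2]

variable {Ω : Type*} {𝒢 𝒜 ℬ m m0 : MeasurableSpace Ω} {R : Measure[m0] Ω}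
  {C : Measure[m0] Ω → Prop} {ρ : Ω → ℝ}

/-- `ρ` is a probability density with respect to `R` that minimizes `∫ ρ log ρ dR` among the
probability densities `q` of finite entropy for which the measure `q R` belongs to the class `C`. -/
structure IsMinDensity (R : Measure[m0] Ω) (C : Measure[m0] Ω → Prop) (ρ : Ω → ℝ) : Prop where
  measurable : Measurable ρ
  nonneg : ∀ ω, 0 ≤ ρ ω
  lintegral_eq_one : ∫⁻ ω, ENNReal.ofReal (ρ ω) ∂ R = 1
  integrable_mul_log : Integrable (fun ω => ρ ω * Real.log (ρ ω)) R
  integral_le : ∀ q : Ω → ℝ, Measurable q → (∀ ω, 0 ≤ q ω) →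
    ∫⁻ ω, ENNReal.ofReal (q ω) ∂ R = 1 → Integrable (fun ω => q ω * Real.log (q ω)) R →
    C (R.withDensity fun ω => ENNReal.ofReal (q ω)) →
    ∫ ω, ρ ω * Real.log (ρ ω) ∂ R ≤ ∫ ω, q ω * Real.log (q ω) ∂ R

theorem IsMinDensity.integrable (h : IsMinDensity R C ρ) : Integrable ρ R := by
  refine ⟨h.measurable.aestronglyMeasurable, ?_⟩
  rw [hasFiniteIntegral_iff_ofReal (Filter.Eventually.of_forall h.nonneg), h.lintegral_eq_one]
  exact ENNReal.one_lt_top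

open scoped Classical in
/-- If replacing `ρ` by `q` on the set `S` gives a competitor, and if `log q` has the same integral
under `ρ R` and `q R` on `S`, then `ρ = q` on `S`: the entropy gained is the relative entropy of
`ρ` with respect to `q` on `S`. -/
theorem IsMinDensity.eq_on_of_replace (h : IsMinDensity R C ρ) {S : Set Ω} (hS : MeasurableSet S)
    {q : Ω → ℝ} (hq : Measurable q) (hq0 : ∀ ω, 0 ≤ q ω)
    (hmass : ∫⁻ ω in S, ENNReal.ofReal (q ω) ∂ R = ∫⁻ ω in S, ENNReal.ofReal (ρ ω) ∂ R)
    (hC : C (R.withDensity fun ω => ENNReal.ofReal (S.piecewise q ρ ω)))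
    (h1 : IntegrableOn (fun ω => q ω * Real.log (q ω)) S R)
    (h2 : IntegrableOn (fun ω => ρ ω * Real.log (q ω)) S R)
    (h3 : ∫ ω in S, q ω * Real.log (q ω) ∂ R = ∫ ω in S, ρ ω * Real.log (q ω) ∂ R)
    (h0 : ∀ᵐ ω ∂ R, q ω = 0 → ρ ω = 0) : ∀ᵐ ω ∂ R, ω ∈ S → ρ ω = q ω := by
  have hρ := h.integrable.integrableOn (s := S)
  have hρl := h.integrable_mul_log
  have hqS : IntegrableOn q S R := by
    refine ⟨hq.aestronglyMeasurable, ?_⟩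
    rw [hasFiniteIntegral_iff_ofReal (Filter.Eventually.of_forall hq0), hmass]
    exact (setLIntegral_le_lintegral _ _).trans_lt (h.lintegral_eq_one ▸ ENNReal.one_lt_top)
  have hmassR : ∫ ω in S, q ω ∂ R = ∫ ω in S, ρ ω ∂ R := by
    rw [integral_eq_lintegral_of_nonneg_ae (Filter.Eventually.of_forall hq0)
      hq.aestronglyMeasurable, hmass, ← integral_eq_lintegral_of_nonneg_ae
      (Filter.Eventually.of_forall h.nonneg) h.measurable.aestronglyMeasurable]
  have hlog : (fun ω => S.piecewise q ρ ω * Real.log (S.piecewise q ρ ω))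
      = S.piecewise (fun ω => q ω * Real.log (q ω)) fun ω => ρ ω * Real.log (ρ ω) := by
    ext ω; by_cases hω : ω ∈ S <;> simp [hω]
  have hint : Integrable (fun ω => S.piecewise q ρ ω * Real.log (S.piecewise q ρ ω)) R := by
    rw [hlog]
    exact Integrable.piecewise hS h1 hρl.integrableOn
  have hle := h.integral_le (S.piecewise q ρ) (hq.piecewise hS h.measurable)
    (fun ω => by by_cases hω : ω ∈ S <;> simp [hω, hq0, h.nonneg])
    (by
      rw [← h.lintegral_eq_one, ← lintegral_add_compl _ hS,
        ← lintegral_add_compl (fun ω => ENNReal.ofReal (ρ ω)) hS, ← hmass]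
      congr 1
      · exact setLIntegral_congr_fun hS fun ω hω => by simp [hω]
      · exact setLIntegral_congr_fun hS.compl fun ω hω => by
          simp only [piecewise_eq_of_notMem S q ρ hω])
    hint hC
  rw [hlog, integral_piecewise hS h1 hρl.integrableOn, ← integral_add_compl hS hρl, h3] at hle
  have hnn : ∀ᵐ ω ∂(R.restrict S),
      0 ≤ ρ ω * Real.log (ρ ω) - ρ ω * Real.log (q ω) - ρ ω + q ω := by
    filter_upwards [ae_restrict_of_ae h0] with ω hω
    exact mul_log_sub_nonneg (h.nonneg ω) (hq0 ω) hω
  have hI : Integrable (fun ω => ρ ω * Real.log (ρ ω) - ρ ω * Real.log (q ω) - ρ ω + q ω)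
      (R.restrict S) := ((hρl.integrableOn.sub h2).sub hρ).add hqS
  have hz : ∫ ω in S, (ρ ω * Real.log (ρ ω) - ρ ω * Real.log (q ω) - ρ ω + q ω) ∂ R = 0 := by
    refine le_antisymm ?_ (integral_nonneg_of_ae hnn)
    have e1 := integral_add ((hρl.integrableOn.sub h2).sub hρ) hqS
    have e2 := integral_sub (hρl.integrableOn.sub h2) hρ
    have e3 := integral_sub hρl.integrableOn h2
    simp only [Pi.sub_apply] at e1 e2 e3
    rw [e1, e2, e3, hmassR]
    linarith
  rw [integral_eq_zero_iff_of_nonneg_ae hnn hI] at hz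
  rw [← ae_restrict_iff' hS]
  filter_upwards [hz, ae_restrict_of_ae h0] with ω hω hω0
  exact eq_of_mul_log_sub_eq_zero (h.nonneg ω) (hq0 ω) hω0 hω

/-- Two densities whose measures agree on a sub-`σ`-field `m` have the same integrals against
`m`-measurable functions. -/
theorem integrable_and_integral_eq_of_agree (hm : m ≤ m0) {q : Ω → ℝ} (hρ : Measurable ρ)
    (hρ0 : ∀ ω, 0 ≤ ρ ω) (hq : Measurable q) (hq0 : ∀ ω, 0 ≤ q ω)
    (hagree : ∀ s, MeasurableSet[m] s → (R.withDensity fun ω => ENNReal.ofReal (ρ ω)) s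
      = (R.withDensity fun ω => ENNReal.ofReal (q ω)) s)
    {S : Set Ω} (hS : MeasurableSet[m] S) {u : Ω → ℝ} (hu : Measurable[m] u)
    (hint : IntegrableOn (fun ω => ρ ω * u ω) S R) :
    IntegrableOn (fun ω => q ω * u ω) S R ∧
      ∫ ω in S, q ω * u ω ∂ R = ∫ ω in S, ρ ω * u ω ∂ R := by
  have key : ∀ r : Ω → ℝ, Measurable r → (∀ ω, 0 ≤ r ω) →
      (IntegrableOn (fun ω => r ω * u ω) S R ↔
        Integrable (S.indicator u) (R.withDensity fun ω => ENNReal.ofReal (r ω))) ∧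
      ∫ ω in S, r ω * u ω ∂ R
        = ∫ ω, S.indicator u ω ∂(R.withDensity fun ω => ENNReal.ofReal (r ω)) := by
    intro r hr hr0
    have he : (fun ω => (ENNReal.ofReal (r ω)).toReal • S.indicator u ω)
        = S.indicator fun ω => r ω * u ω := by
      ext ω
      by_cases hω : ω ∈ S <;> simp [hω, hr0]
    have hfin : ∀ᵐ ω ∂ R, ENNReal.ofReal (r ω) < ∞ :=
      Filter.Eventually.of_forall fun _ => ENNReal.ofReal_lt_top
    constructor
    · rw [integrable_withDensity_iff_integrable_smul' hr.ennreal_ofReal hfin, he,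
        integrable_indicator_iff (hm _ hS)]
    · rw [integral_withDensity_eq_integral_toReal_smul hr.ennreal_ofReal hfin, he,
        integral_indicator (hm _ hS)]
  have hsm : StronglyMeasurable[m] (S.indicator u) :=
    @Measurable.stronglyMeasurable _ _ _ _ _ _ _ _ _ (hu.indicator hS)
  have ht := trim_eq_of_forall_eq hm hagree
  have hI := (key ρ hρ hρ0).1.1 hint
  refine ⟨(key q hq hq0).1.2 (integrable_of_integrable_trim hm (ht ▸ hI.trim hm hsm)), ?_⟩
  rw [(key q hq hq0).2, (key ρ hρ hρ0).2, integral_trim hm hsm, integral_trim hm hsm, ht]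

/-- A function vanishes where its conditional expectation does. -/
theorem condLExp_eq_zero_imp (hm : m ≤ m0) [SigmaFinite (R.trim hm)] {X : Ω → ℝ≥0∞}
    (hX : Measurable X) : ∀ᵐ ω ∂ R, condLExp m R X ω = 0 → X ω = 0 := by
  have hs : MeasurableSet[m] {ω | condLExp m R X ω = 0} :=
    measurable_condLExp m R X (measurableSet_singleton 0)
  have h := setLIntegral_condLExp hm R X hs
  rw [setLIntegral_congr_fun (g := fun _ => 0) (hm _ hs) fun ω hω => hω, lintegral_zero,
    eq_comm, lintegral_eq_zero_iff hX] at h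
  exact (ae_restrict_iff' (hm _ hs)).1 h

/-- On a set of finite `R`-measure, the log-density of the projection of `ρ R` to a sub-`σ`-field
is integrable under `ρ R`: from above because the entropy decreases under projection, from below
because `x log x` is bounded from below. -/
theorem IsMinDensity.integrableOn_mul_log_condLExp (h : IsMinDensity R C ρ) (hm : m ≤ m0)
    [SigmaFinite (R.trim hm)] {S : Set Ω} (hS : MeasurableSet[m] S) (hSR : R S ≠ ∞) :
    IntegrableOn (fun ω => ρ ω *
      Real.log (condLExp m R (fun ω => ENNReal.ofReal (ρ ω)) ω).toReal) S R := by
  set a := condLExp m R (fun ω => ENNReal.ofReal (ρ ω)) with ha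
  have hρm : Measurable fun ω => ENNReal.ofReal (ρ ω) := h.measurable.ennreal_ofReal
  have ham : Measurable[m] a := measurable_condLExp _ _ _
  have ham0 : Measurable a := ham.mono hm le_rfl
  have haint : Integrable (fun ω => (a ω).toReal) R := by
    refine integrable_toReal_of_lintegral_ne_top ham0.aemeasurable ?_
    rw [ha, lintegral_condLExp hm, h.lintegral_eq_one]
    exact ENNReal.one_ne_top
  have hafin : ∀ᵐ ω ∂ R, a ω ≠ ∞ :=
    condLExp_ne_top (by rw [h.lintegral_eq_one]; exact ENNReal.one_ne_top)
  have hSm := hm _ hS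
  -- The negative part of `log a`: `∫ ρ u dR = ∫ a u dR` on `S`, and `a u ≤ 1`.
  let u : Ω → ℝ := fun ω => max (-Real.log (a ω).toReal) 0
  have hum : Measurable[m] u := by
    exact (Real.measurable_log.comp ham.ennreal_toReal).neg.max measurable_const
  have hρu : IntegrableOn (fun ω => ρ ω * u ω) S R := by
    refine ⟨(h.measurable.mul (hum.mono hm le_rfl)).aestronglyMeasurable, ?_⟩
    rw [hasFiniteIntegral_iff_ofReal (Filter.Eventually.of_forall fun ω =>
      mul_nonneg (h.nonneg ω) (le_max_right _ _))]
    calc ∫⁻ ω in S, ENNReal.ofReal (ρ ω * u ω) ∂ R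
        = ∫⁻ ω, S.indicator (fun ω => ENNReal.ofReal (u ω)) ω * ENNReal.ofReal (ρ ω) ∂ R := by
          rw [← lintegral_indicator hSm]
          refine lintegral_congr fun ω => ?_
          by_cases hω : ω ∈ S
          · simp [hω, ENNReal.ofReal_mul (h.nonneg ω), mul_comm]
          · simp [hω]
      _ = ∫⁻ ω, S.indicator (fun ω => ENNReal.ofReal (u ω)) ω * a ω ∂ R :=
          (lintegral_mul_condLExp hm (hum.ennreal_ofReal.indicator hS) hρm).symm
      _ ≤ ∫⁻ ω, S.indicator 1 ω ∂ R := by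
          refine lintegral_mono_ae ?_
          filter_upwards [hafin] with ω hω
          by_cases hωS : ω ∈ S
          · simp only [hωS, indicator_of_mem, Pi.one_apply]
            have hau : ENNReal.ofReal (u ω) * a ω = ENNReal.ofReal (u ω * (a ω).toReal) := by
              rw [ENNReal.ofReal_mul (le_max_right _ _), ENNReal.ofReal_toReal hω]
            rw [hau, ← ENNReal.ofReal_one]
            refine ENNReal.ofReal_le_ofReal ?_
            simp only [u]
            have ht : 0 ≤ (a ω).toReal := ENNReal.toReal_nonneg
            generalize (a ω).toReal = x at ht
            rcases ht.eq_or_lt with rfl | hx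
            · simp
            rw [max_mul_of_nonneg _ _ hx.le]
            refine max_le ?_ (by simp)
            have := Real.log_le_sub_one_of_pos (inv_pos.2 hx)
            rw [Real.log_inv] at this
            have h2 := mul_le_mul_of_nonneg_right this hx.le
            rw [sub_mul, inv_mul_cancel₀ hx.ne'] at h2
            linarith
          · simp [hωS]
      _ = R S := lintegral_indicator_one hSm
      _ < ∞ := hSR.lt_top
  refine Integrable.mono' (((h.integrable_mul_log.norm.add h.integrable).add haint).integrableOn.add
    hρu) (h.measurable.mul (Real.measurable_log.comp ham0.ennreal_toReal)).aestronglyMeasurable ?_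
  refine Filter.Eventually.of_forall fun ω => ?_
  simp only [Pi.add_apply, Real.norm_eq_abs, u]
  have ha0 : 0 ≤ (a ω).toReal := ENNReal.toReal_nonneg
  generalize (a ω).toReal = x at ha0
  have hρ0 := h.nonneg ω
  have hl := abs_nonneg (ρ ω * Real.log (ρ ω))
  rcases le_total (Real.log x) 0 with hx | hx
  · rw [abs_of_nonpos (mul_nonpos_of_nonneg_of_nonpos hρ0 hx), max_eq_left (by linarith)]
    linarith
  · rw [abs_of_nonneg (mul_nonneg hρ0 hx), max_eq_right (by linarith)]
    rcases ha0.eq_or_lt with rfl | hx0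
    · simp; positivity
    have h1 := mul_log_sub_nonneg hρ0 ha0 (fun h => absurd h hx0.ne')
    have h2 := le_abs_self (ρ ω * Real.log (ρ ω))
    linarith

end MinDensity

/-! ### Constraints on two conditionally independent blocks -/

section Product

variable {Ω : Type*} {𝒢 𝒜 ℬ m0 : MeasurableSpace Ω} {R : Measure[m0] Ω}

theorem CondIndepGiven.symm (h : CondIndepGiven 𝒢 𝒜 ℬ R) : CondIndepGiven 𝒢 ℬ 𝒜 R := by
  intro A B hA hB
  filter_upwards [h B A hB hA] with ω hω
  rw [inter_comm, hω, Pi.mul_apply, Pi.mul_apply, mul_comm]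

/-- The tower property of the conditional expectation. -/
theorem condLExp_condLExp (h : 𝒢 ≤ 𝒜) (h𝒜 : 𝒜 ≤ m0) [SigmaFinite (R.trim (h.trans h𝒜))]
    (X : Ω → ℝ≥0∞) : condLExp 𝒢 R (condLExp 𝒜 R X) =ᵐ[R] condLExp 𝒢 R X := by
  have := sigmaFiniteTrim_mono (μ := R) h𝒜 h
  refine ae_eq_condLExp (h.trans h𝒜) R X (measurable_condLExp _ _ _) fun s hs => ?_
  rw [setLIntegral_condLExp _ _ _ hs, setLIntegral_condLExp h𝒜 _ _ (h s hs)]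

/-- If `a`, `b`, `g` are the densities of the projections of `r R` on `𝒜`, `ℬ` and `𝒢`, then the
measure with density `a b / g` agrees with `r R` on `𝒜`. -/
theorem CondIndepGiven.lintegral_mul_div (hci : CondIndepGiven 𝒢 𝒜 ℬ R) (h𝒢𝒜 : 𝒢 ≤ 𝒜)
    (h𝒢ℬ : 𝒢 ≤ ℬ) (h𝒜 : 𝒜 ≤ m0) (hℬ : ℬ ≤ m0) [SigmaFinite (R.trim (h𝒢𝒜.trans h𝒜))]
    {r : Ω → ℝ≥0∞} (hr : Measurable r) (hr1 : ∫⁻ ω, r ω ∂ R ≠ ∞) {f : Ω → ℝ≥0∞}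
    (hf : Measurable[𝒜] f) :
    ∫⁻ ω, f ω * (condLExp 𝒜 R r ω * condLExp ℬ R r ω * (condLExp 𝒢 R r ω)⁻¹) ∂ R
      = ∫⁻ ω, f ω * r ω ∂ R := by
  have := sigmaFiniteTrim_mono (μ := R) h𝒜 h𝒢𝒜
  have h𝒢 := h𝒢𝒜.trans h𝒜
  have hga := condLExp_condLExp (R := R) h𝒢𝒜 h𝒜 r
  have hgb := condLExp_condLExp (R := R) h𝒢ℬ hℬ r
  set a := condLExp 𝒜 R r
  set b := condLExp ℬ R r
  set g := condLExp 𝒢 R r with hg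
  have ham : Measurable[𝒜] a := measurable_condLExp _ _ _
  have hbm : Measurable[ℬ] b := measurable_condLExp _ _ _
  have hgm : Measurable[𝒢] g := measurable_condLExp _ _ _
  calc ∫⁻ ω, f ω * (a ω * b ω * (g ω)⁻¹) ∂ R
      = ∫⁻ ω, (f ω * a ω * (g ω)⁻¹) * b ω ∂ R := lintegral_congr fun ω => by ring
    _ = ∫⁻ ω, (f ω * a ω * (g ω)⁻¹) * condLExp 𝒢 R b ω ∂ R :=
        hci.lintegral_mul h𝒢 h𝒜 hℬ ((hf.mul ham).mul (hgm.mono h𝒢𝒜 le_rfl).inv) hbm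
    _ = ∫⁻ ω, f ω * a ω ∂ R := by
        refine lintegral_congr_ae ?_
        filter_upwards [hga, hgb, condLExp_ne_top (mΩ := 𝒢) hr1,
          condLExp_eq_zero_imp (R := R) h𝒢 (ham.mono h𝒜 le_rfl)] with ω h1 h2 h3 h4
        rw [h2, mul_assoc]
        rw [h1] at h4
        by_cases h0 : g ω = 0
        · simp [h4 h0]
        · rw [ENNReal.inv_mul_cancel h0 h3, mul_one]
    _ = ∫⁻ ω, f ω * r ω ∂ R := lintegral_mul_condLExp h𝒜 hf hr

open scoped Classical in
/-- If `𝒜` and `ℬ` are conditionally independent given `𝒢` under `R`, and if the constraints only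
see the restrictions of a measure to `𝒜` and to `ℬ`, then a density of minimal entropy is the
product `a b / g` of the densities of its projections on `𝒜`, `ℬ` and `𝒢`. -/
theorem IsMinDensity.eq_mul_div {C : Measure[m0] Ω → Prop} {ρ : Ω → ℝ} (h : IsMinDensity R C ρ)
    (hci : CondIndepGiven 𝒢 𝒜 ℬ R) (h𝒢𝒜 : 𝒢 ≤ 𝒜) (h𝒢ℬ : 𝒢 ≤ ℬ) (h𝒜 : 𝒜 ≤ m0) (hℬ : ℬ ≤ m0)
    [SigmaFinite (R.trim (h𝒢𝒜.trans h𝒜))]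
    (hC : ∀ Q : Measure[m0] Ω,
      (∀ A, MeasurableSet[𝒜] A → Q A = (R.withDensity fun ω => ENNReal.ofReal (ρ ω)) A) →
      (∀ B, MeasurableSet[ℬ] B → Q B = (R.withDensity fun ω => ENNReal.ofReal (ρ ω)) B) → C Q) :
    ∀ᵐ ω ∂ R, ENNReal.ofReal (ρ ω) = condLExp 𝒜 R (fun ω => ENNReal.ofReal (ρ ω)) ω *
      condLExp ℬ R (fun ω => ENNReal.ofReal (ρ ω)) ω *
      (condLExp 𝒢 R (fun ω => ENNReal.ofReal (ρ ω)) ω)⁻¹ := by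
  have σ𝒜 := sigmaFiniteTrim_mono (μ := R) h𝒜 h𝒢𝒜
  have σℬ : SigmaFinite (R.trim hℬ) := sigmaFiniteTrim_mono (μ := R) hℬ h𝒢ℬ
  have h𝒢 := h𝒢𝒜.trans h𝒜
  set r : Ω → ℝ≥0∞ := fun ω => ENNReal.ofReal (ρ ω) with hr
  have hrm : Measurable r := h.measurable.ennreal_ofReal
  have hr1 : ∫⁻ ω, r ω ∂ R ≠ ∞ := by rw [h.lintegral_eq_one]; exact ENNReal.one_ne_top
  have hga := condLExp_condLExp (R := R) h𝒢𝒜 h𝒜 r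
  have mA : ∀ f, Measurable[𝒜] f → _ := fun f hf =>
    hci.lintegral_mul_div h𝒢𝒜 h𝒢ℬ h𝒜 hℬ hrm hr1 (f := f) hf
  have mB : ∀ f, Measurable[ℬ] f → _ := fun f hf =>
    hci.symm.lintegral_mul_div h𝒢ℬ h𝒢𝒜 hℬ h𝒜 hrm hr1 (f := f) hf
  have ia := fun S hS hSR => h.integrableOn_mul_log_condLExp (m := 𝒜) h𝒜 (S := S) hS hSR
  have ib := fun S hS hSR => h.integrableOn_mul_log_condLExp (m := ℬ) hℬ (S := S) hS hSR
  have ig := fun S hS hSR => h.integrableOn_mul_log_condLExp (m := 𝒢) h𝒢 (S := S) hS hSR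
  have atop : ∀ᵐ ω ∂ R, condLExp 𝒜 R r ω ≠ ∞ := condLExp_ne_top hr1
  have btop : ∀ᵐ ω ∂ R, condLExp ℬ R r ω ≠ ∞ := condLExp_ne_top hr1
  have gtop : ∀ᵐ ω ∂ R, condLExp 𝒢 R r ω ≠ ∞ := condLExp_ne_top hr1
  have a0 := condLExp_eq_zero_imp (R := R) h𝒜 hrm
  have b0 := condLExp_eq_zero_imp (R := R) hℬ hrm
  have g0 := condLExp_eq_zero_imp (R := R) h𝒢 hrm
  have ga0 := condLExp_eq_zero_imp (R := R) h𝒢 (measurable_condLExp' 𝒜 R r)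
  have ham : Measurable[𝒜] (condLExp 𝒜 R r) := measurable_condLExp _ _ _
  have hbm : Measurable[ℬ] (condLExp ℬ R r) := measurable_condLExp _ _ _
  have hgm : Measurable[𝒢] (condLExp 𝒢 R r) := measurable_condLExp _ _ _
  rw [← hr] at ia ib ig
  generalize condLExp 𝒜 R r = a at *
  generalize condLExp ℬ R r = b at *
  generalize condLExp 𝒢 R r = g at *
  have ham0 := ham.mono h𝒜 le_rfl
  have hbm0 := hbm.mono hℬ le_rfl
  have hgm0 := hgm.mono h𝒢 le_rfl
  let q : Ω → ℝ := fun ω => (a ω * b ω * (g ω)⁻¹).toReal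
  have hqm : Measurable q := ((ham0.mul hbm0).mul hgm0.inv).ennreal_toReal
  have hq0 : ∀ ω, 0 ≤ q ω := fun ω => ENNReal.toReal_nonneg
  have hqtop : ∀ᵐ ω ∂ R, a ω * b ω * (g ω)⁻¹ ≠ ∞ := by
    filter_upwards [atop, btop, gtop, hga, ga0] with ω h1 h2 h3 h4 h5
    by_cases hg : g ω = 0
    · simp [h5 (h4.trans hg)]
    · exact ENNReal.mul_ne_top (ENNReal.mul_ne_top h1 h2) (ENNReal.inv_ne_top.2 hg)
  have hqof : ∀ᵐ ω ∂ R, ENNReal.ofReal (q ω) = a ω * b ω * (g ω)⁻¹ := by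
    filter_upwards [hqtop] with ω hω using ENNReal.ofReal_toReal hω
  -- The measure with density `q` agrees with the measure with density `ρ` on `𝒜` and on `ℬ`.
  have agree : ∀ (m : MeasurableSpace Ω) (hm : m ≤ m0),
      (∀ f, Measurable[m] f →
        ∫⁻ ω, f ω * (a ω * b ω * (g ω)⁻¹) ∂ R = ∫⁻ ω, f ω * r ω ∂ R) →
      ∀ s, MeasurableSet[m] s →
        ∫⁻ ω in s, ENNReal.ofReal (ρ ω) ∂ R = ∫⁻ ω in s, ENNReal.ofReal (q ω) ∂ R := by
    intro m hm hmf s hs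
    have key := hmf (s.indicator 1) (Measurable.indicator (@measurable_const _ _ _ m 1) hs)
    rw [← lintegral_indicator (hm s hs), ← lintegral_indicator (hm s hs)]
    calc ∫⁻ ω, s.indicator (fun ω => ENNReal.ofReal (ρ ω)) ω ∂ R
        = ∫⁻ ω, s.indicator 1 ω * r ω ∂ R :=
          lintegral_congr fun ω => by by_cases hω : ω ∈ s <;> simp [hω, hr]
      _ = ∫⁻ ω, s.indicator 1 ω * (a ω * b ω * (g ω)⁻¹) ∂ R := key.symm
      _ = ∫⁻ ω, s.indicator (fun ω => ENNReal.ofReal (q ω)) ω ∂ R := by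
          refine lintegral_congr_ae ?_
          filter_upwards [hqof] with ω hω
          by_cases hωs : ω ∈ s <;> simp [hωs, hω]
  have agA := agree 𝒜 h𝒜 mA
  have agB := agree ℬ hℬ fun f hf => by
    rw [← mB f hf]
    exact lintegral_congr fun ω => by rw [mul_comm (a ω)]
  have agA' : ∀ s, MeasurableSet[𝒜] s → (R.withDensity fun ω => ENNReal.ofReal (ρ ω)) s
      = (R.withDensity fun ω => ENNReal.ofReal (q ω)) s := fun s hs => by
    rw [withDensity_apply _ (h𝒜 s hs), withDensity_apply _ (h𝒜 s hs), agA s hs]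
  have agB' : ∀ s, MeasurableSet[ℬ] s → (R.withDensity fun ω => ENNReal.ofReal (ρ ω)) s
      = (R.withDensity fun ω => ENNReal.ofReal (q ω)) s := fun s hs => by
    rw [withDensity_apply _ (hℬ s hs), withDensity_apply _ (hℬ s hs), agB s hs]
  have hlogq : ∀ᵐ ω ∂ R, ρ ω * Real.log (q ω) = ρ ω * Real.log (a ω).toReal
      + ρ ω * Real.log (b ω).toReal - ρ ω * Real.log (g ω).toReal := by
    filter_upwards [a0, b0, g0, atop, btop, gtop] with ω h1 h2 h3 h4 h5 h6
    by_cases hρ : ρ ω = 0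
    · simp [hρ]
    have hrω : r ω ≠ 0 := by
      simpa [hr] using lt_of_le_of_ne (h.nonneg ω) (Ne.symm hρ)
    have ha := ENNReal.toReal_ne_zero.2 ⟨mt h1 hrω, h4⟩
    have hb := ENNReal.toReal_ne_zero.2 ⟨mt h2 hrω, h5⟩
    have hg := ENNReal.toReal_ne_zero.2 ⟨mt h3 hrω, h6⟩
    simp only [q, ENNReal.toReal_mul, ENNReal.toReal_inv]
    rw [Real.log_mul (mul_ne_zero ha hb) (inv_ne_zero hg), Real.log_mul ha hb, Real.log_inv]
    ring
  have hlogq' : ∀ ω, q ω * Real.log (q ω) = q ω * Real.log (a ω).toReal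
      + q ω * Real.log (b ω).toReal - q ω * Real.log (g ω).toReal := by
    intro ω
    by_cases hq : q ω = 0
    · simp [hq]
    have hq' := hq
    simp only [q, ENNReal.toReal_mul, ENNReal.toReal_inv] at hq'
    have hab := left_ne_zero_of_mul hq'
    have ha := left_ne_zero_of_mul hab
    have hb := right_ne_zero_of_mul hab
    have hg := right_ne_zero_of_mul hq'
    have : Real.log (q ω)
        = Real.log (a ω).toReal + Real.log (b ω).toReal - Real.log (g ω).toReal := by
      simp only [q, ENNReal.toReal_mul, ENNReal.toReal_inv]
      rw [Real.log_mul hab hg, Real.log_mul ha hb, Real.log_inv]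
      ring
    rw [this]
    ring
  have hq0ρ : ∀ᵐ ω ∂ R, q ω = 0 → ρ ω = 0 := by
    filter_upwards [a0, b0, g0, atop, btop, gtop] with ω h1 h2 h3 h4 h5 h6 hq
    by_contra hρ
    have hrω : r ω ≠ 0 := by
      simpa [hr] using lt_of_le_of_ne (h.nonneg ω) (Ne.symm hρ)
    have ha := ENNReal.toReal_ne_zero.2 ⟨mt h1 hrω, h4⟩
    have hb := ENNReal.toReal_ne_zero.2 ⟨mt h2 hrω, h5⟩
    have hg := ENNReal.toReal_ne_zero.2 ⟨mt h3 hrω, h6⟩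
    simp only [q, ENNReal.toReal_mul, ENNReal.toReal_inv] at hq
    exact mul_ne_zero (mul_ne_zero ha hb) (inv_ne_zero hg) hq
  -- The comparison is made on sets of finite measure exhausting the space.
  -- There `log q = log a + log b - log g` has the same integral under `ρ R` and `q R`, term by
  -- term.
  have local_eq : ∀ S, MeasurableSet[𝒢] S → R S ≠ ∞ → ∀ᵐ ω ∂ R, ω ∈ S → ρ ω = q ω := by
    intro S hS hSR
    have hS0 := h𝒢 S hS
    have lg : ∀ {x : Ω → ℝ≥0∞} {m : MeasurableSpace Ω}, Measurable[m] x →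
        Measurable[m] fun ω => Real.log (x ω).toReal :=
      fun hx => Real.measurable_log.comp hx.ennreal_toReal
    have IA := ia S (h𝒢𝒜 S hS) hSR
    have IB := ib S (h𝒢ℬ S hS) hSR
    have IG := ig S hS hSR
    obtain ⟨ja, ea⟩ := integrable_and_integral_eq_of_agree h𝒜 h.measurable h.nonneg hqm hq0 agA'
      (h𝒢𝒜 S hS) (lg ham) IA
    obtain ⟨jb, eb⟩ := integrable_and_integral_eq_of_agree hℬ h.measurable h.nonneg hqm hq0 agB'
      (h𝒢ℬ S hS) (lg hbm) IB
    obtain ⟨jg, eg⟩ := integrable_and_integral_eq_of_agree h𝒢 h.measurable h.nonneg hqm hq0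
      (fun s hs => agA' s (h𝒢𝒜 s hs)) hS (lg hgm) IG
    have hcomp : ∀ (m : MeasurableSpace Ω) (hm : m ≤ m0), 𝒢 ≤ m →
        (∀ s, MeasurableSet[m] s →
          ∫⁻ ω in s, ENNReal.ofReal (ρ ω) ∂ R = ∫⁻ ω in s, ENNReal.ofReal (q ω) ∂ R) →
        ∀ s, MeasurableSet[m] s →
          (R.withDensity fun ω => ENNReal.ofReal (S.piecewise q ρ ω)) s
            = (R.withDensity fun ω => ENNReal.ofReal (ρ ω)) s := by
      intro m hm h𝒢m hag s hs
      have hs0 := hm s hs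
      rw [withDensity_apply _ hs0, withDensity_apply _ hs0, ← lintegral_inter_add_sdiff _ s hS0,
        ← lintegral_inter_add_sdiff (fun ω => ENNReal.ofReal (ρ ω)) s hS0,
        hag _ (hs.inter (h𝒢m S hS))]
      congr 1
      · exact setLIntegral_congr_fun (hs0.inter hS0) fun ω hω => by
          simp only [piecewise_eq_of_mem S q ρ hω.2]
      · exact setLIntegral_congr_fun (hs0.diff hS0) fun ω hω => by
          simp only [piecewise_eq_of_notMem S q ρ hω.2]
    refine h.eq_on_of_replace hS0 hqm hq0 (agA S (h𝒢𝒜 S hS)).symm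
      (hC _ (hcomp 𝒜 h𝒜 h𝒢𝒜 agA) (hcomp ℬ hℬ h𝒢ℬ agB)) ?_ ?_ ?_ hq0ρ
    · simp_rw [hlogq']
      exact (ja.add jb).sub jg
    · exact ((IA.add IB).sub IG).congr (ae_restrict_of_ae (hlogq.mono fun ω hω => hω.symm))
    · rw [integral_congr_ae (ae_restrict_of_ae hlogq)]
      simp_rw [hlogq']
      have e1 := integral_sub (ja.add jb) jg
      have e2 := integral_add ja jb
      have e3 := integral_sub (IA.add IB) IG
      have e4 := integral_add IA IB
      simp only [Pi.add_apply] at e1 e2 e3 e4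
      rw [e1, e2, e3, e4, ea, eb, eg]
  have hall : ∀ᵐ ω ∂ R, ∀ n, ω ∈ spanningSets (R.trim h𝒢) n → ρ ω = q ω := by
    rw [ae_all_iff]
    intro n
    exact local_eq _ (measurableSet_spanningSets _ n)
      (measure_spanningSets_trim_lt_top h𝒢 R n).ne
  filter_upwards [hall, hqof] with ω h1 h2
  obtain ⟨n, hn⟩ := mem_iUnion.1 ((iUnion_spanningSets (R.trim h𝒢)).symm ▸ mem_univ ω)
  rw [h1 n hn, h2]

/-- A product density preserves conditional independence. -/
theorem CondIndepGiven.of_density (hci : CondIndepGiven 𝒢 𝒜 ℬ R) (h𝒢𝒜 : 𝒢 ≤ 𝒜)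
    (h𝒢ℬ : 𝒢 ≤ ℬ) (h𝒜 : 𝒜 ≤ m0) (hℬ : ℬ ≤ m0) [SigmaFinite (R.trim (h𝒢𝒜.trans h𝒜))]
    {r : Ω → ℝ≥0∞} (hr : Measurable r) (hr1 : ∫⁻ ω, r ω ∂ R ≠ ∞)
    (hprod : r =ᵐ[R] fun ω => condLExp 𝒜 R r ω * condLExp ℬ R r ω * (condLExp 𝒢 R r ω)⁻¹) :
    CondIndepGiven 𝒢 𝒜 ℬ (R.withDensity r) := by
  intro A B hA hB
  have σ𝒜 := sigmaFiniteTrim_mono (μ := R) h𝒜 h𝒢𝒜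
  have σℬ : SigmaFinite (R.trim hℬ) := sigmaFiniteTrim_mono (μ := R) hℬ h𝒢ℬ
  have h𝒢 := h𝒢𝒜.trans h𝒜
  have : IsFiniteMeasure (R.withDensity r) := isFiniteMeasure_withDensity hr1
  have hA0 := h𝒜 A hA
  have hB0 := hℬ B hB
  have ham : Measurable[𝒜] (condLExp 𝒜 R r) := measurable_condLExp _ _ _
  have hbm : Measurable[ℬ] (condLExp ℬ R r) := measurable_condLExp _ _ _
  have hgm : Measurable[𝒢] (condLExp 𝒢 R r) := measurable_condLExp _ _ _
  have hgtop : ∀ᵐ ω ∂ R, condLExp 𝒢 R r ω ≠ ∞ := condLExp_ne_top hr1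
  have hwd : ∀ {f : Ω → ℝ≥0∞} {s : Set Ω}, Measurable f → MeasurableSet s →
      ∫⁻ ω in s, f ω ∂(R.withDensity r) = ∫⁻ ω, s.indicator f ω * r ω ∂ R := by
    intro f s hf hs
    rw [← lintegral_indicator hs, lintegral_withDensity_eq_lintegral_mul _ hr (hf.indicator hs)]
    simp [mul_comm]
  have hset : ∀ {s D : Set Ω}, MeasurableSet s → MeasurableSet D →
      ∫⁻ ω in s, D.indicator 1 ω ∂(R.withDensity r)
        = ∫⁻ ω, s.indicator 1 ω * D.indicator 1 ω * r ω ∂ R := by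
    intro s D hs hD
    rw [hwd (f := D.indicator 1) (measurable_one.indicator hD) hs]
    refine lintegral_congr fun ω => ?_
    by_cases h1 : ω ∈ s <;> simp [h1]
  have hind : ∀ {m : MeasurableSpace Ω} {s : Set Ω}, MeasurableSet[m] s →
      Measurable[m] (s.indicator (1 : Ω → ℝ≥0∞)) := fun hs =>
    Measurable.indicator (measurable_const (a := (1 : ℝ≥0∞))) hs
  have hwA : Measurable[𝒜] fun ω => A.indicator 1 ω * condLExp 𝒜 R r ω := (hind hA).mul ham
  have hwB : Measurable[ℬ] fun ω => B.indicator 1 ω * condLExp ℬ R r ω := (hind hB).mul hbm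
  -- The conditional probability of an event `D` of one block is `E(1_D d | 𝒢) / g`.
  have one : ∀ (m : MeasurableSpace Ω) (h𝒢m : 𝒢 ≤ m) (hm : m ≤ m0) (D : Set Ω),
      MeasurableSet[m] D → SigmaFinite (R.trim hm) →
      (fun ω => condLExp 𝒢 R (fun ω => D.indicator 1 ω * condLExp m R r ω) ω
        * (condLExp 𝒢 R r ω)⁻¹) =ᵐ[R.withDensity r]
        condLExp 𝒢 (R.withDensity r) (D.indicator 1) := by
    intro m h𝒢m hm D hD σm
    have hw : Measurable[m] fun ω => D.indicator 1 ω * condLExp m R r ω :=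
      (hind hD).mul (measurable_condLExp _ _ _)
    have hw0 := hw.mono hm le_rfl
    have hxm := measurable_condLExp 𝒢 R (fun ω => D.indicator 1 ω * condLExp m R r ω)
    have hx0 : ∀ᵐ ω ∂ R, condLExp 𝒢 R r ω = 0 →
        condLExp 𝒢 R (fun ω => D.indicator 1 ω * condLExp m R r ω) ω = 0 := by
      have hmono : condLExp 𝒢 R (fun ω => D.indicator 1 ω * condLExp m R r ω)
          ≤ᵐ[R] condLExp 𝒢 R (condLExp m R r) := by
        refine condLExp_mono (Filter.Eventually.of_forall fun ω => ?_)
        by_cases hω : ω ∈ D <;> simp [hω]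
      filter_upwards [hmono, condLExp_condLExp (R := R) h𝒢m hm r] with ω h1 h2 h3
      exact le_antisymm (h1.trans (h2.trans h3).le) bot_le
    refine ae_eq_condLExp h𝒢 _ _ (hxm.mul hgm.inv) fun s hs => ?_
    have hs0 := h𝒢 s hs
    have hxg : Measurable[𝒢] fun ω => condLExp 𝒢 R (fun ω => D.indicator 1 ω * condLExp m R r ω) ω
        * (condLExp 𝒢 R r ω)⁻¹ := hxm.mul hgm.inv
    rw [hwd (hxg.mono h𝒢 le_rfl) hs0, hset hs0 (hm D hD)]
    calc _ = ∫⁻ ω, s.indicator (fun ω => condLExp 𝒢 R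
              (fun ω => D.indicator 1 ω * condLExp m R r ω) ω * (condLExp 𝒢 R r ω)⁻¹) ω
              * condLExp 𝒢 R r ω ∂ R :=
          (lintegral_mul_condLExp h𝒢 ((hxm.mul hgm.inv).indicator hs) hr).symm
      _ = ∫⁻ ω, s.indicator 1 ω * condLExp 𝒢 R
              (fun ω => D.indicator 1 ω * condLExp m R r ω) ω ∂ R := by
          refine lintegral_congr_ae ?_
          filter_upwards [hx0, hgtop] with ω h1 h2
          by_cases hω : ω ∈ s
          · by_cases hg : condLExp 𝒢 R r ω = 0
            · simp [hω, h1 hg]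
            · simp only [hω, indicator_of_mem, Pi.one_apply, one_mul]
              rw [mul_assoc, ENNReal.inv_mul_cancel hg h2, mul_one]
          · simp [hω]
      _ = ∫⁻ ω, s.indicator 1 ω * (D.indicator 1 ω * condLExp m R r ω) ∂ R :=
          lintegral_mul_condLExp h𝒢 (hind hs) hw0
      _ = ∫⁻ ω, s.indicator 1 ω * D.indicator 1 ω * condLExp m R r ω ∂ R := by
          simp_rw [mul_assoc]
      _ = _ := lintegral_mul_condLExp hm ((hind (h𝒢m s hs)).mul (hind hD)) hr
  have hA1 := one 𝒜 h𝒢𝒜 h𝒜 A hA σ𝒜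
  have hB1 := one ℬ h𝒢ℬ hℬ B hB σℬ
  have hxA0 : ∀ᵐ ω ∂ R, condLExp 𝒢 R r ω = 0 →
      condLExp 𝒢 R (fun ω => A.indicator 1 ω * condLExp 𝒜 R r ω) ω = 0 := by
    have hmono : condLExp 𝒢 R (fun ω => A.indicator 1 ω * condLExp 𝒜 R r ω)
        ≤ᵐ[R] condLExp 𝒢 R (condLExp 𝒜 R r) := by
      refine condLExp_mono (Filter.Eventually.of_forall fun ω => ?_)
      by_cases hω : ω ∈ A <;> simp [hω]
    filter_upwards [hmono, condLExp_condLExp (R := R) h𝒢𝒜 h𝒜 r] with ω h1 h2 h3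
    exact le_antisymm (h1.trans (h2.trans h3).le) bot_le
  set x := condLExp 𝒢 R (fun ω => A.indicator 1 ω * condLExp 𝒜 R r ω) with hx
  set y := condLExp 𝒢 R (fun ω => B.indicator 1 ω * condLExp ℬ R r ω) with hy
  have hxm : Measurable[𝒢] x := measurable_condLExp _ _ _
  have hym : Measurable[𝒢] y := measurable_condLExp _ _ _
  -- Likewise for `A ∩ B`: conditional independence under `R` splits `E(1_A a 1_B b | 𝒢)`.
  have hAB : (fun ω => (x ω * (condLExp 𝒢 R r ω)⁻¹) * (y ω * (condLExp 𝒢 R r ω)⁻¹))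
      =ᵐ[R.withDensity r] condLExp 𝒢 (R.withDensity r) ((A ∩ B).indicator 1) := by
    have hzm : Measurable[𝒢] fun ω =>
        (x ω * (condLExp 𝒢 R r ω)⁻¹) * (y ω * (condLExp 𝒢 R r ω)⁻¹) :=
      (hxm.mul hgm.inv).mul (hym.mul hgm.inv)
    refine ae_eq_condLExp h𝒢 _ _ hzm fun s hs => ?_
    have hs0 := h𝒢 s hs
    rw [hwd (hzm.mono h𝒢 le_rfl) hs0, hset hs0 (hA0.inter hB0)]
    calc _ = ∫⁻ ω, s.indicator (fun ω =>
              (x ω * (condLExp 𝒢 R r ω)⁻¹) * (y ω * (condLExp 𝒢 R r ω)⁻¹)) ω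
              * condLExp 𝒢 R r ω ∂ R :=
          (lintegral_mul_condLExp h𝒢 (hzm.indicator hs) hr).symm
      _ = ∫⁻ ω, (s.indicator 1 ω * (condLExp 𝒢 R r ω)⁻¹ * y ω) * x ω ∂ R := by
          refine lintegral_congr_ae ?_
          filter_upwards [hxA0, hgtop] with ω h1 h2
          by_cases hω : ω ∈ s
          · by_cases hg : condLExp 𝒢 R r ω = 0
            · simp [hω, h1 hg]
            · simp only [hω, indicator_of_mem, Pi.one_apply, one_mul]
              calc x ω * (condLExp 𝒢 R r ω)⁻¹ * (y ω * (condLExp 𝒢 R r ω)⁻¹) * condLExp 𝒢 R r ω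
                  = x ω * (condLExp 𝒢 R r ω)⁻¹ * y ω
                    * ((condLExp 𝒢 R r ω)⁻¹ * condLExp 𝒢 R r ω) := by ring
                _ = _ := by rw [ENNReal.inv_mul_cancel hg h2]; ring
          · simp [hω]
      _ = ∫⁻ ω, (s.indicator 1 ω * (condLExp 𝒢 R r ω)⁻¹ * y ω)
            * (A.indicator 1 ω * condLExp 𝒜 R r ω) ∂ R :=
          lintegral_mul_condLExp h𝒢 (((hind hs).mul hgm.inv).mul hym) (hwA.mono h𝒜 le_rfl)
      _ = ∫⁻ ω, (s.indicator 1 ω * (condLExp 𝒢 R r ω)⁻¹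
            * (A.indicator 1 ω * condLExp 𝒜 R r ω)) * y ω ∂ R :=
          lintegral_congr fun ω => by ring
      _ = ∫⁻ ω, (s.indicator 1 ω * (condLExp 𝒢 R r ω)⁻¹
            * (A.indicator 1 ω * condLExp 𝒜 R r ω))
            * (B.indicator 1 ω * condLExp ℬ R r ω) ∂ R :=
          (hci.lintegral_mul h𝒢 h𝒜 hℬ
            ((((hind hs).mul hgm.inv).mono h𝒢𝒜 le_rfl).mul hwA) hwB).symm
      _ = _ := by
          refine lintegral_congr_ae ?_
          filter_upwards [hprod] with ω hω
          rw [inter_indicator_one, Pi.mul_apply]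
          rw [hω]
          ring
  filter_upwards [hAB, hA1, hB1] with ω h1 h2 h3
  rw [← h1, h2, h3, Pi.mul_apply]

end Product

/-! ### Solutions of the Brödinger problem, and their reciprocity -/

section Weight

variable {Ω : Type*} [MeasurableSpace Ω] {R : Measure Ω}

theorem integrable_withDensity_ofReal_iff {q : Ω → ℝ} (hq : Measurable q) (hq0 : ∀ ω, 0 ≤ q ω)
    {u : Ω → ℝ} : Integrable u (R.withDensity fun ω => ENNReal.ofReal (q ω)) ↔
      Integrable (fun ω => q ω * u ω) R := by
  rw [integrable_withDensity_iff_integrable_smul' hq.ennreal_ofReal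
    (Filter.Eventually.of_forall fun _ => ENNReal.ofReal_lt_top)]
  simp [hq0]

theorem integral_withDensity_ofReal {q : Ω → ℝ} (hq : Measurable q) (hq0 : ∀ ω, 0 ≤ q ω)
    (u : Ω → ℝ) : ∫ ω, u ω ∂(R.withDensity fun ω => ENNReal.ofReal (q ω)) =
      ∫ ω, q ω * u ω ∂ R := by
  rw [integral_withDensity_eq_integral_toReal_smul hq.ennreal_ofReal
    (Filter.Eventually.of_forall fun _ => ENNReal.ofReal_lt_top)]
  simp [hq0]

/-- A probability density `q` with `q log q` integrable has a weight: the negative part of `log q`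
where `q` is positive, and any function with integrable exponential where `q` vanishes. -/
theorem exists_isWeight [SigmaFinite R] {q : Ω → ℝ} (hq : Measurable q) (hq0 : ∀ ω, 0 ≤ q ω)
    (hq1 : ∫⁻ ω, ENNReal.ofReal (q ω) ∂ R = 1)
    (hlog : Integrable (fun ω => q ω * Real.log (q ω)) R) :
    ∃ W : Ω → ℝ, IsWeight R (R.withDensity fun ω => ENNReal.ofReal (q ω)) W := by
  obtain ⟨w, hw0, hwm, hw1⟩ := exists_pos_lintegral_lt_of_sigmaFinite R one_ne_zero
  have hwm' : Measurable fun ω => (w ω : ℝ) := hwm.coe_nnreal_real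
  have hwi : Integrable (fun ω => (w ω : ℝ)) R := by
    refine ⟨hwm'.aestronglyMeasurable, ?_⟩
    rw [hasFiniteIntegral_iff_ofReal (Filter.Eventually.of_forall fun ω => NNReal.coe_nonneg _)]
    simpa using hw1.trans ENNReal.one_lt_top
  have hqi : Integrable q R := by
    refine ⟨hq.aestronglyMeasurable, ?_⟩
    rw [hasFiniteIntegral_iff_ofReal (Filter.Eventually.of_forall hq0), hq1]
    exact ENNReal.one_lt_top
  have hset : MeasurableSet {ω | q ω = 0} := hq (measurableSet_singleton 0)
  let W : Ω → ℝ := fun ω =>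
    if q ω = 0 then -Real.log (min (w ω : ℝ) 1) else max (-Real.log (q ω)) 0
  have hWm : Measurable W :=
    Measurable.ite hset (Real.measurable_log.comp (hwm'.min measurable_const)).neg
      ((Real.measurable_log.comp hq).neg.max measurable_const)
  have hWnn : ∀ ω, 0 ≤ W ω := by
    intro ω
    simp only [W]
    split_ifs
    · have : 0 < min (w ω : ℝ) 1 := lt_min (hw0 ω) one_pos
      linarith [Real.log_nonpos this.le (min_le_right _ _)]
    · exact le_max_right _ _
  refine ⟨W, hWm, hWnn, ?_, ?_⟩
  · refine Integrable.mono' (hwi.add hqi) (Real.measurable_exp.comp hWm.neg).aestronglyMeasurable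
      (Filter.Eventually.of_forall fun ω => ?_)
    rw [Real.norm_eq_abs, abs_of_pos (Real.exp_pos _)]
    simp only [W, Pi.add_apply]
    split_ifs with h
    · have hpos : 0 < min (w ω : ℝ) 1 := lt_min (hw0 ω) one_pos
      rw [neg_neg, Real.exp_log hpos, h, add_zero]
      exact min_le_left _ _
    · have hpos : 0 < q ω := (hq0 ω).lt_of_ne (Ne.symm h)
      calc Real.exp (-max (-Real.log (q ω)) 0) ≤ Real.exp (Real.log (q ω)) :=
            Real.exp_le_exp.2 (by linarith [le_max_left (-Real.log (q ω)) 0])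
        _ = q ω := Real.exp_log hpos
        _ ≤ _ := le_add_of_nonneg_left (w ω).2
  · rw [integrable_withDensity_ofReal_iff hq hq0]
    refine Integrable.mono hlog (hq.mul hWm).aestronglyMeasurable
      (Filter.Eventually.of_forall fun ω => ?_)
    simp only [W, norm_mul, Real.norm_eq_abs]
    split_ifs with h
    · simp [h]
    · refine mul_le_mul_of_nonneg_left ?_ (abs_nonneg _)
      rw [abs_of_nonneg (le_max_right _ _)]
      exact max_le (neg_le_abs _) (abs_nonneg _)

/-- The relative entropy of a measure with density `q` is `∫ q log q dR`. -/
theorem isRelEntropy_withDensity [SigmaFinite R] {q : Ω → ℝ} (hq : Measurable q)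
    (hq0 : ∀ ω, 0 ≤ q ω) (hq1 : ∫⁻ ω, ENNReal.ofReal (q ω) ∂ R = 1)
    (hlog : Integrable (fun ω => q ω * Real.log (q ω)) R) :
    IsRelEntropy R (R.withDensity fun ω => ENNReal.ofReal (q ω))
      ((∫ ω, q ω * Real.log (q ω) ∂ R : ℝ) : EReal) := by
  obtain ⟨W, hW⟩ := exists_isWeight hq hq0 hq1 hlog
  have hprob : IsProbabilityMeasure (R.withDensity fun ω => ENNReal.ofReal (q ω)) :=
    ⟨by rw [withDensity_apply _ MeasurableSet.univ, setLIntegral_univ, hq1]⟩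
  have hllr : (fun ω => q ω * llr (R.withDensity fun ω => ENNReal.ofReal (q ω)) R ω)
      =ᵐ[R] fun ω => q ω * Real.log (q ω) := by
    filter_upwards [Measure.rnDeriv_withDensity R hq.ennreal_ofReal] with ω hω
    rw [llr, hω, ENNReal.toReal_ofReal (hq0 ω)]
  refine ⟨W, hW, ?_⟩
  rw [relEntropyVia_eq hW, if_pos, integral_withDensity_ofReal hq hq0, integral_congr_ae hllr]
  refine ⟨withDensity_absolutelyContinuous _ _, ?_⟩
  rw [integrable_withDensity_ofReal_iff hq hq0]
  exact hlog.congr hllr.symm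

end Weight

section PathSigma

variable {𝓧 : Type*} [TopologicalSpace 𝓧] [MeasurableSpace 𝓧]

theorem measurable_eval_pathSigma {S : Set I} {t : I} (ht : t ∈ S) :
    Measurable[pathSigma S] fun ω : C(I, 𝓧) => ω t :=
  Measurable.of_comap_le (le_iSup₂ (f := fun (t : I) (_ : t ∈ S) =>
    MeasurableSpace.comap (fun ω : C(I, 𝓧) => ω t) inferInstance) t ht)

theorem pathSigma_mono {S T : Set I} (h : S ⊆ T) :
    (pathSigma S : MeasurableSpace C(I, 𝓧)) ≤ pathSigma T :=
  iSup₂_le fun _ ht => (measurable_eval_pathSigma (h ht)).comap_le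

theorem map_eq_of_forall_eq {Ω β : Type*} [MeasurableSpace β] {m m0 : MeasurableSpace Ω}
    {P Q : Measure[m0] Ω} (hm : m ≤ m0) (h : ∀ s, MeasurableSet[m] s → Q s = P s)
    {f : Ω → β} (hf : Measurable[m] f) : Q.map f = P.map f := by
  ext s hs
  rw [Measure.map_apply (hf.mono hm le_rfl) hs, Measure.map_apply (hf.mono hm le_rfl) hs,
    h _ (hf hs)]

end PathSigma

section Solution

variable {𝓧 : Type*} [TopologicalSpace 𝓧] [MeasurableSpace 𝓧] [MeasurableSpace C(I, 𝓧)]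
    {R P : Measure C(I, 𝓧)} {𝒯 : Set I} {μ : I → Measure 𝓧} {π : Measure (𝓧 × 𝓧)}

theorem IsSolution.absolutelyContinuous [SigmaFinite R] (hP : IsSolution R 𝒯 μ π P) : P ≪ R := by
  have := hP.1.isProbabilityMeasure
  obtain ⟨h, ⟨W, hW, rfl⟩, hlt, -⟩ := hP.2
  rw [relEntropyVia_eq hW] at hlt
  split_ifs at hlt with hc
  · exact hc.1
  · exact absurd hlt (lt_irrefl _)

/-- The class of path measures that satisfy the same constraints as `P`: the same law at the times
in `𝒯` and the same joint law at the endpoints. -/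
def SameConstraints (𝒯 : Set I) (P Q : Measure C(I, 𝓧)) : Prop :=
  (∀ t ∈ 𝒯, law Q t = law P t) ∧ law₂ Q 0 1 = law₂ P 0 1

theorem IsSolution.withDensity_toReal_rnDeriv [SigmaFinite R] (hP : IsSolution R 𝒯 μ π P) :
    R.withDensity (fun ω => ENNReal.ofReal (P.rnDeriv R ω).toReal) = P := by
  have := hP.1.isProbabilityMeasure
  rw [withDensity_congr_ae (g := P.rnDeriv R),
    Measure.withDensity_rnDeriv_eq P R hP.absolutelyContinuous]
  filter_upwards [Measure.rnDeriv_ne_top P R] with ω hω using ENNReal.ofReal_toReal hω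

/-- The density of a solution minimizes `∫ ρ log ρ dR` under the constraints. -/
theorem IsSolution.isMinDensity [SigmaFinite R] (hP : IsSolution R 𝒯 μ π P) :
    IsMinDensity R (SameConstraints 𝒯 P) fun ω => (P.rnDeriv R ω).toReal := by
  have := hP.1.isProbabilityMeasure
  have hac := hP.absolutelyContinuous
  have hwd := hP.withDensity_toReal_rnDeriv
  obtain ⟨hcomp, h, ⟨W, hW, rfl⟩, hlt, hmin⟩ := hP
  rw [relEntropyVia_eq hW] at hlt hmin
  split_ifs at hlt hmin with hc
  swap
  · exact absurd hlt (lt_irrefl _)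
  refine ⟨(Measure.measurable_rnDeriv P R).ennreal_toReal, fun ω => ENNReal.toReal_nonneg, ?_, ?_,
    fun q hq hq0 hq1 hlog hC => ?_⟩
  · rw [← setLIntegral_univ, ← withDensity_apply _ MeasurableSet.univ, hwd, measure_univ]
  · exact (integrable_rnDeriv_mul_log_iff hac).2 hc.2
  · have hQ : IsCompetitor 𝒯 μ π (R.withDensity fun ω => ENNReal.ofReal (q ω)) :=
      ⟨⟨by rw [withDensity_apply _ MeasurableSet.univ, setLIntegral_univ, hq1]⟩,
        fun t ht => (hC.1 t ht).trans (hcomp.marginal t ht), hC.2.trans hcomp.endpoint⟩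
    have hle := hmin _ _ hQ (isRelEntropy_withDensity hq hq0 hq1 hlog)
    rw [EReal.coe_le_coe_iff] at hle
    have he := integral_rnDeriv_mul_log hac
    exact he.trans_le hle

variable [BorelSpace 𝓧] [BorelSpace C(I, 𝓧)]

theorem measurable_eval (t : I) : Measurable fun ω : C(I, 𝓧) => ω t :=
  (continuous_eval_const t).measurable

theorem IsConditionable.sigmaFinite (h : IsConditionable R) : SigmaFinite R := by
  have := h 0
  exact SigmaFinite.of_map R (measurable_eval 0).aemeasurable this

/-- A solution is reciprocal when the reference measure is. -/
theorem IsSolution.isReciprocal (hR : IsReciprocal R) (hP : IsSolution R 𝒯 μ π P) :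
    IsReciprocal P := by
  have := hP.1.isProbabilityMeasure
  have := hR.1.sigmaFinite
  have hwd := hP.withDensity_toReal_rnDeriv
  refine ⟨fun t => ?_, fun s u hs hsu hu => ?_⟩
  · have : IsProbabilityMeasure (law P t) :=
      Measure.isProbabilityMeasure_map (measurable_eval t).aemeasurable
    infer_instance
  have hci : CondIndepGiven (pathSigma {s, u}) (pathSigma (Iic s ∪ Ici u)) (pathSigma (Icc s u))
      R := fun A B hA hB => hR.2 s u hs hsu hu A B hA hB
  have h1 : (pathSigma {s, u} : MeasurableSpace C(I, 𝓧)) ≤ pathSigma (Iic s ∪ Ici u) :=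
    pathSigma_mono (by
      rintro x (rfl | rfl)
      · exact Or.inl (mem_Iic.2 le_rfl)
      · exact Or.inr (mem_Ici.2 le_rfl))
  have h2 : (pathSigma {s, u} : MeasurableSpace C(I, 𝓧)) ≤ pathSigma (Icc s u) :=
    pathSigma_mono (by
      rintro x (rfl | rfl)
      · exact ⟨le_rfl, hsu.le⟩
      · exact ⟨hsu.le, le_rfl⟩)
  have hσ : SigmaFinite (R.trim (h1.trans (pathSigma_le _))) :=
    hR.1.sigmaFinite_trim ⟨s, Or.inl rfl⟩
  have hmin := hP.isMinDensity
  have hprod := hmin.eq_mul_div hci h1 h2 (pathSigma_le _) (pathSigma_le _) (fun Q hA hB => by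
    rw [hwd] at hA hB
    refine ⟨fun t _ => ?_, map_eq_of_forall_eq (pathSigma_le _) hA
      ((measurable_eval_pathSigma (Or.inl hs.le)).prodMk
        (measurable_eval_pathSigma (Or.inr hu.le)))⟩
    by_cases ht : t ∈ Iic s ∪ Ici u
    · exact map_eq_of_forall_eq (pathSigma_le _) hA (measurable_eval_pathSigma ht)
    · refine map_eq_of_forall_eq (pathSigma_le _) hB (measurable_eval_pathSigma ?_)
      simp only [mem_union, mem_Iic, mem_Ici, not_or, not_le] at ht
      exact ⟨ht.1.le, ht.2.le⟩)
  have := hci.of_density h1 h2 (pathSigma_le _) (pathSigma_le _) hmin.measurable.ennreal_ofReal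
    (by rw [hmin.lintegral_eq_one]; exact ENNReal.one_ne_top) hprod
  rw [hwd] at this
  exact fun A B hA hB => this A B hA hB

end Solution

/-! ### The first variation of the entropy -/

section Perturbation

variable {F : Type*} [MeasurableSpace F] {R : Measure F}

/-- A measure on `S` dominated by `g R` has a density that is dominated by `g` everywhere and
vanishes everywhere outside `S`. -/
theorem exists_density_le [SigmaFinite R] {ν : Measure F} [IsFiniteMeasure ν] {g : F → ℝ}
    (hg : Measurable g) (hg0 : ∀ x, 0 ≤ g x)
    (hν : ν ≤ R.withDensity fun x => ENNReal.ofReal (g x)) {S : Set F} (hS : MeasurableSet S)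
    (hνS : ν Sᶜ = 0) :
    ∃ s : F → ℝ, Measurable s ∧ (∀ x, 0 ≤ s x) ∧ (∀ x, s x ≤ g x) ∧ (∀ x, x ∉ S → s x = 0) ∧
      R.withDensity (fun x => ENNReal.ofReal (s x)) = ν := by
  have hac : ν ≪ R :=
    (Measure.absolutelyContinuous_of_le hν).trans (withDensity_absolutelyContinuous _ _)
  have hrm := Measure.measurable_rnDeriv ν R
  have hle : ∀ᵐ x ∂ R, ν.rnDeriv R x ≤ ENNReal.ofReal (g x) := by
    refine ae_le_of_forall_setLIntegral_le_of_sigmaFinite hrm fun A hA _ => ?_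
    rw [Measure.setLIntegral_rnDeriv hac, ← withDensity_apply _ hA]
    exact hν A
  have hzero : ∀ᵐ x ∂ R, x ∉ S → ν.rnDeriv R x = 0 := by
    have h0 : ∫⁻ x in Sᶜ, ν.rnDeriv R x ∂ R = 0 := by rw [Measure.setLIntegral_rnDeriv hac, hνS]
    rw [lintegral_eq_zero_iff hrm] at h0
    exact (ae_restrict_iff' hS.compl).1 h0
  refine ⟨S.indicator fun x => min (ν.rnDeriv R x).toReal (g x),
    (hrm.ennreal_toReal.min hg).indicator hS,
    fun x => indicator_nonneg (fun x _ => le_min ENNReal.toReal_nonneg (hg0 x)) x,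
    fun x => indicator_le' (fun x _ => min_le_right _ _) (fun x _ => hg0 x) x,
    fun x hx => indicator_of_notMem hx _, ?_⟩
  conv_rhs => rw [← Measure.withDensity_rnDeriv_eq ν R hac]
  refine withDensity_congr_ae ?_
  filter_upwards [hle, hzero] with x h1 h2
  by_cases hx : x ∈ S
  · have hfin : ν.rnDeriv R x ≠ ∞ := ne_top_of_le_ne_top ENNReal.ofReal_ne_top h1
    rw [indicator_of_mem hx, min_eq_left (ENNReal.toReal_le_of_le_ofReal (hg0 x) h1),
      ENNReal.ofReal_toReal hfin]
  · rw [indicator_of_notMem hx, h2 hx, ENNReal.ofReal_zero]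

theorem exists_bound_mul_log (M : ℝ) :
    ∃ K : ℝ, 0 ≤ K ∧ ∀ x, 0 ≤ x → x ≤ M → |x * Real.log x| ≤ K := by
  obtain ⟨K, hK⟩ := (isCompact_Icc (a := (0 : ℝ)) (b := M)).exists_bound_of_continuousOn
    Real.continuous_mul_log.continuousOn
  exact ⟨max K 0, le_max_right _ _, fun x h0 hM => (hK x ⟨h0, hM⟩).trans (le_max_left _ _)⟩

theorem integrable_of_bounded_on {S : Set F} (hS : MeasurableSet S) (hSR : R S ≠ ∞) {f : F → ℝ}
    (hf : Measurable f) {K : ℝ} (hK : ∀ x ∈ S, |f x| ≤ K) (h0 : ∀ x, x ∉ S → f x = 0) :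
    Integrable f R := by
  have h1 : IntegrableOn f S R := by
    refine Measure.integrableOn_of_bounded hSR hf.aestronglyMeasurable (M := K) ?_
    exact (ae_restrict_iff' hS).2 (Filter.Eventually.of_forall hK)
  rwa [← integrable_indicator_iff hS, indicator_eq_self.2] at h1
  intro x hx
  by_contra hxS
  exact hx (h0 x hxS)

/-- The first variation inequality at a density `ρ` of minimal entropy: moving mass from `ν₂` to
`ν₁` without changing the constraints does not decrease `∫ log ρ`, up to the error `δ` that keeps
the logarithms finite. -/
theorem IsMinDensity.integral_log_le [SigmaFinite R] {C : Measure F → Prop} {ρ : F → ℝ}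
    (h : IsMinDensity R C ρ) {κ : Type*} {β : κ → Type*} [∀ k, MeasurableSpace (β k)]
    {Y : ∀ k, F → β k} (hY : ∀ k, Measurable (Y k))
    (hC : ∀ Q : Measure F, (∀ k, Q.map (Y k)
      = (R.withDensity fun x => ENNReal.ofReal (ρ x)).map (Y k)) → C Q)
    {ν₁ ν₂ : Measure F} [IsFiniteMeasure ν₁] [IsFiniteMeasure ν₂] {M : ℝ} (hM : 1 ≤ M)
    (h₁ : ν₁ ≤ R.withDensity fun _ => ENNReal.ofReal M)
    (h₂ : ν₂ ≤ R.withDensity fun x => ENNReal.ofReal (M * ρ x))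
    {S : Set F} (hS : MeasurableSet S) (hSR : R S ≠ ∞) (hSρ : ∀ x ∈ S, ρ x ≤ M)
    (h₁S : ν₁ Sᶜ = 0) (h₂S : ν₂ Sᶜ = 0) (hmap : ∀ k, ν₁.map (Y k) = ν₂.map (Y k))
    (hmass : ν₁ univ = ν₂ univ) {δ : ℝ} (hδ : 0 < δ) (hδ1 : δ < 1) :
    Integrable (fun x => Real.log (ρ x + δ)) ν₁ ∧
      Integrable (fun x => Real.log ((1 - δ) * ρ x)) ν₂ ∧
      ∫ x, Real.log ((1 - δ) * ρ x) ∂ν₂ ≤ ∫ x, Real.log (ρ x + δ) ∂ν₁ := by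
  have hM0 : 0 < M := one_pos.trans_le hM
  have hρ0 := h.nonneg
  obtain ⟨s, hsm, hs0, hsM, hsS, hs⟩ :=
    exists_density_le measurable_const (fun _ => hM0.le) h₁ hS h₁S
  obtain ⟨d, hdm, hd0, hdM, hdS, hd⟩ := exists_density_le (h.measurable.const_mul M)
    (fun x => mul_nonneg hM0.le (hρ0 x)) h₂ hS h₂S
  have hδ' : 0 < 1 - δ := by linarith
  have hlm₁ : Measurable fun x => Real.log (ρ x + δ) :=
    Real.measurable_log.comp (h.measurable.add_const δ)
  have hlm₂ : Measurable fun x => Real.log ((1 - δ) * ρ x) :=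
    Real.measurable_log.comp (h.measurable.const_mul _)
  obtain ⟨K, hK0, hK⟩ := exists_bound_mul_log (M + 1)
  have I₁ : Integrable (fun x => s x * Real.log (ρ x + δ)) R := by
    refine integrable_of_bounded_on hS hSR (hsm.mul hlm₁)
      (K := M * (|Real.log δ| + |Real.log (M + 1)|)) (fun x hx => ?_) fun x hx => by simp [hsS x hx]
    rw [abs_mul, abs_of_nonneg (hs0 x)]
    refine mul_le_mul (hsM x) ?_ (abs_nonneg _) hM0.le
    have h1 : Real.log δ ≤ Real.log (ρ x + δ) :=
      Real.log_le_log hδ (by linarith [hρ0 x])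
    have h2 : Real.log (ρ x + δ) ≤ Real.log (M + 1) :=
      Real.log_le_log (by linarith [hρ0 x]) (by linarith [hSρ x hx])
    rw [abs_le]
    constructor
    · linarith [neg_abs_le (Real.log δ), abs_nonneg (Real.log (M + 1))]
    · linarith [le_abs_self (Real.log (M + 1)), abs_nonneg (Real.log δ)]
  have I₂ : Integrable (fun x => d x * Real.log ((1 - δ) * ρ x)) R := by
    refine integrable_of_bounded_on hS hSR (hdm.mul hlm₂) (K := M * (K / (1 - δ)))
      (fun x hx => ?_) fun x hx => by simp [hdS x hx]
    rw [abs_mul, abs_of_nonneg (hd0 x)]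
    calc d x * |Real.log ((1 - δ) * ρ x)| ≤ M * ρ x * |Real.log ((1 - δ) * ρ x)| :=
          mul_le_mul_of_nonneg_right (hdM x) (abs_nonneg _)
      _ = M * (|((1 - δ) * ρ x) * Real.log ((1 - δ) * ρ x)| / (1 - δ)) := by
          rw [abs_mul ((1 - δ) * ρ x), abs_of_nonneg (mul_nonneg hδ'.le (hρ0 x))]
          field_simp
      _ ≤ M * (K / (1 - δ)) := by
          have := hK ((1 - δ) * ρ x) (mul_nonneg hδ'.le (hρ0 x))
            (by nlinarith [hSρ x hx, hρ0 x])
          gcongr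
  -- With `ε M = δ`, the perturbed density `q` stays between `(1 - δ) ρ` and `ρ + δ`.
  obtain ⟨ε, hε, hεM⟩ : ∃ ε : ℝ, 0 < ε ∧ ε * M = δ := ⟨δ / M, div_pos hδ hM0, by field_simp⟩
  let q : F → ℝ := fun x => ρ x + ε * (s x - d x)
  have hqm : Measurable q := h.measurable.add ((hsm.sub hdm).const_mul ε)
  have hqlow : ∀ x, (1 - δ) * ρ x + ε * s x ≤ q x := fun x => by
    have := mul_le_mul_of_nonneg_left (hdM x) hε.le
    rw [← mul_assoc, hεM] at this
    simp only [q]; linarith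
  have hqup : ∀ x, q x ≤ ρ x + δ := fun x => by
    have h1 := mul_le_mul_of_nonneg_left (hsM x) hε.le
    have h2 := mul_nonneg hε.le (hd0 x)
    simp only [q]; linarith
  have hq0 : ∀ x, 0 ≤ q x := fun x =>
    (add_nonneg (mul_nonneg hδ'.le (hρ0 x)) (mul_nonneg hε.le (hs0 x))).trans (hqlow x)
  have hqρ : ∀ x, q x = 0 → ρ x = 0 ∧ s x = 0 := fun x hx => by
    have h1 := hqlow x
    have h2 := mul_nonneg hδ'.le (hρ0 x)
    have h3 := mul_nonneg hε.le (hs0 x)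
    constructor
    · have : (1 - δ) * ρ x = 0 := by linarith
      exact (mul_eq_zero.1 this).resolve_left hδ'.ne'
    · have : ε * s x = 0 := by linarith
      exact (mul_eq_zero.1 this).resolve_left hε.ne'
  have hqS : ∀ x, x ∉ S → q x = ρ x := fun x hx => by simp [q, hsS x hx, hdS x hx]
  have hdiff : Integrable (fun x => q x * Real.log (q x) - ρ x * Real.log (ρ x)) R := by
    refine integrable_of_bounded_on hS hSR ((hqm.mul (Real.measurable_log.comp hqm)).sub
      (h.measurable.mul (Real.measurable_log.comp h.measurable))) (K := K + K) (fun x hx => ?_)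
      fun x hx => by simp [hqS x hx]
    have h1 := hK (q x) (hq0 x) (by linarith [hqup x, hSρ x hx])
    have h2 := hK (ρ x) (hρ0 x) (by linarith [hSρ x hx])
    exact (abs_sub _ _).trans (add_le_add h1 h2)
  have hqI : Integrable (fun x => q x * Real.log (q x)) R := by
    have := hdiff.add h.integrable_mul_log
    refine this.congr (Filter.Eventually.of_forall fun x => ?_)
    simp
  have smass : ∫⁻ x, ENNReal.ofReal (s x) ∂ R = ν₁ univ := by
    rw [← hs, withDensity_apply _ MeasurableSet.univ, setLIntegral_univ]
  have dmass : ∫⁻ x, ENNReal.ofReal (d x) ∂ R = ν₂ univ := by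
    rw [← hd, withDensity_apply _ MeasurableSet.univ, setLIntegral_univ]
  have sint : Integrable s R := by
    refine ⟨hsm.aestronglyMeasurable, ?_⟩
    rw [hasFiniteIntegral_iff_ofReal (Filter.Eventually.of_forall hs0), smass]
    exact measure_lt_top _ _
  have dint : Integrable d R := by
    refine ⟨hdm.aestronglyMeasurable, ?_⟩
    rw [hasFiniteIntegral_iff_ofReal (Filter.Eventually.of_forall hd0), dmass]
    exact measure_lt_top _ _
  have sd : ∫ x, s x ∂ R = ∫ x, d x ∂ R := by
    rw [integral_eq_lintegral_of_nonneg_ae (Filter.Eventually.of_forall hs0)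
      hsm.aestronglyMeasurable, integral_eq_lintegral_of_nonneg_ae
      (Filter.Eventually.of_forall hd0) hdm.aestronglyMeasurable, smass, dmass, hmass]
  -- As measures, `q R + ε ν₂ = ρ R + ε ν₁`, so that `q R` satisfies the same constraints.
  have hbal : (R.withDensity fun x => ENNReal.ofReal (q x)) + ENNReal.ofReal ε • ν₂
      = (R.withDensity fun x => ENNReal.ofReal (ρ x)) + ENNReal.ofReal ε • ν₁ := by
    rw [← hs, ← hd, ← withDensity_smul _ hsm.ennreal_ofReal,
      ← withDensity_smul _ hdm.ennreal_ofReal, ← withDensity_add_left hqm.ennreal_ofReal,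
      ← withDensity_add_left h.measurable.ennreal_ofReal]
    congr 1
    ext x
    simp only [Pi.add_apply, Pi.smul_apply, smul_eq_mul]
    rw [← ENNReal.ofReal_mul hε.le, ← ENNReal.ofReal_mul hε.le,
      ← ENNReal.ofReal_add (hq0 x) (mul_nonneg hε.le (hd0 x)),
      ← ENNReal.ofReal_add (hρ0 x) (mul_nonneg hε.le (hs0 x))]
    simp only [q]
    ring_nf
  have hcomp : C (R.withDensity fun x => ENNReal.ofReal (q x)) := by
    refine hC _ fun k => ?_
    ext A hA
    have hb := congrArg (fun μ => μ (Y k ⁻¹' A)) hbal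
    have hν := congrArg (fun μ => μ A) (hmap k)
    simp only [Measure.map_apply (hY k) hA] at hν ⊢
    simp only [Measure.add_apply, Measure.smul_apply, smul_eq_mul, hν] at hb
    exact (ENNReal.add_left_inj
      (ENNReal.mul_ne_top ENNReal.ofReal_ne_top (measure_ne_top _ _))).1 hb
  have hq1 : ∫⁻ x, ENNReal.ofReal (q x) ∂ R = 1 := by
    have hb := congrArg (fun μ => μ univ) hbal
    simp only [Measure.add_apply, Measure.smul_apply, smul_eq_mul, hmass,
      withDensity_apply _ MeasurableSet.univ, setLIntegral_univ, h.lintegral_eq_one] at hb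
    exact (ENNReal.add_left_inj
      (ENNReal.mul_ne_top ENNReal.ofReal_ne_top (measure_ne_top _ _))).1 hb
  have hle := h.integral_le q hqm hq0 hq1 hqI hcomp
  -- By convexity, `q log q - ρ log ρ ≤ (q - ρ) log q + (q - ρ)`; then `log q` is bounded above
  -- against `s` and below against `d`.
  have hpt : ∀ x, q x * Real.log (q x) - ρ x * Real.log (ρ x)
      ≤ ε * ((s x * Real.log (ρ x + δ) - d x * Real.log ((1 - δ) * ρ x)) + (s x - d x)) := by
    intro x
    have h1 := mul_log_sub_nonneg (hρ0 x) (hq0 x) fun hx => (hqρ x hx).1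
    have h2 : s x * Real.log (q x) ≤ s x * Real.log (ρ x + δ) := by
      rcases (hq0 x).eq_or_lt with hx | hx
      · simp [(hqρ x hx.symm).2]
      · exact mul_le_mul_of_nonneg_left (Real.log_le_log hx (hqup x)) (hs0 x)
    have h3 : d x * Real.log ((1 - δ) * ρ x) ≤ d x * Real.log (q x) := by
      rcases (hρ0 x).eq_or_lt with hx | hx
      · have : d x = 0 := le_antisymm (by simpa [← hx] using hdM x) (hd0 x)
        simp [this]
      · refine mul_le_mul_of_nonneg_left (Real.log_le_log (mul_pos hδ' hx) ?_) (hd0 x)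
        linarith [hqlow x, mul_nonneg hε.le (hs0 x)]
    have h4 : q x - ρ x = ε * (s x - d x) := by simp [q]
    have h5 : q x * Real.log (q x) - ρ x * Real.log (q x)
        = ε * (s x * Real.log (q x) - d x * Real.log (q x)) := by
      rw [← sub_mul, h4]; ring
    have h6 := mul_le_mul_of_nonneg_left (sub_le_sub h2 h3) hε.le
    linarith
  have hint : 0 ≤ ∫ x, ε * ((s x * Real.log (ρ x + δ) - d x * Real.log ((1 - δ) * ρ x))
      + (s x - d x)) ∂ R := by
    refine le_trans ?_ (integral_mono hdiff (((I₁.sub I₂).add (sint.sub dint)).const_mul ε) hpt)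
    rw [integral_sub hqI h.integrable_mul_log]
    linarith
  have e1 := integral_add (I₁.sub I₂) (sint.sub dint)
  have e2 := integral_sub I₁ I₂
  have e3 := integral_sub sint dint
  simp only [Pi.sub_apply] at e1 e2 e3
  rw [integral_const_mul, e1, e2, e3, sd] at hint
  have hfinal := nonneg_of_mul_nonneg_right hint hε
  refine ⟨?_, ?_, ?_⟩
  · rw [← hs, integrable_withDensity_ofReal_iff hsm hs0]; exact I₁
  · rw [← hd, integrable_withDensity_ofReal_iff hdm hd0]; exact I₂
  · rw [← hs, ← hd, integral_withDensity_ofReal hsm hs0, integral_withDensity_ofReal hdm hd0]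
    linarith

end Perturbation

/-! ### Cyclical monotonicity of minimal densities -/

section Shuffle

variable {ι E : Type*}

/-- The array obtained from the array `y` by permuting its `i`-th column with `e i`. Its rows mix
coordinates of different rows of `y`. -/
def shuffle (e : ι → Equiv.Perm ι) (y : ι → ι → E) : ι → ι → E := fun j i => y (e i j) i

theorem shuffle_shuffle_symm (e : ι → Equiv.Perm ι) (y : ι → ι → E) :
    shuffle (fun i => (e i).symm) (shuffle e y) = y := by
  ext j i
  simp [shuffle]

variable [MeasurableSpace E]

theorem measurable_shuffle (e : ι → Equiv.Perm ι) :
    Measurable (shuffle e : (ι → ι → E) → ι → ι → E) :=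
  measurable_pi_lambda _ fun j => measurable_pi_lambda _ fun i =>
    (measurable_pi_apply i).comp (measurable_pi_apply (e i j))

variable [Fintype ι]

/-- If the coordinates of a row of the shuffled array come from different rows, then for
independent rows of law `P` they are independent, so that the row has the product of the marginals
of `P` as its law. -/
theorem map_shuffle_row (e : ι → Equiv.Perm ι) (j : ι) (he : Function.Injective fun i => e i j)
    (P : Measure (ι → E)) [IsProbabilityMeasure P] :
    (Measure.pi fun _ : ι => P).map (fun y => shuffle e y j)
      = Measure.pi fun i => P.map (fun x => x i) := by
  have hprob : ∀ i : ι, IsProbabilityMeasure (P.map fun x => x i) := fun i =>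
    Measure.isProbabilityMeasure_map (measurable_pi_apply i).aemeasurable
  refine (Measure.pi_eq fun s hs => ?_).symm
  have hrow : Measurable fun y : ι → ι → E => shuffle e y j :=
    (measurable_pi_apply j).comp (measurable_shuffle e)
  rw [Measure.map_apply hrow (MeasurableSet.univ_pi hs)]
  let ψ : Equiv.Perm ι := Equiv.ofBijective _ (Finite.injective_iff_bijective.1 he)
  have hset : (fun y : ι → ι → E => shuffle e y j) ⁻¹' univ.pi s
      = univ.pi fun k => (fun x : ι → E => x (ψ.symm k)) ⁻¹' s (ψ.symm k) := by
    ext y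
    simp only [mem_preimage, mem_univ_pi, shuffle]
    constructor
    · intro h k
      have := h (ψ.symm k)
      have hk : e (ψ.symm k) j = k := ψ.apply_symm_apply k
      rwa [hk] at this
    · intro h i
      have := h (ψ i)
      rwa [ψ.symm_apply_apply] at this
  rw [hset, Measure.pi_pi, ← Equiv.prod_comp ψ]
  refine Finset.prod_congr rfl fun i _ => ?_
  rw [ψ.symm_apply_apply, Measure.map_apply (measurable_pi_apply i) (hs i)]

/-- If all entries of the array are independent, with the same law along each column, then
shuffling preserves the law of the array. -/
theorem measurePreserving_shuffle (e : ι → Equiv.Perm ι) (ν : ι → Measure E)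
    [∀ i, IsProbabilityMeasure (ν i)] :
    MeasurePreserving (shuffle e) (Measure.pi fun _ : ι => Measure.pi ν)
      (Measure.pi fun _ : ι => Measure.pi ν) := by
  refine ⟨measurable_shuffle e, (Measure.pi_eq_generateFrom (fun _ => generateFrom_pi)
    (fun _ => isPiSystem_pi) (fun _ => ?_) fun s hs => ?_).symm⟩
  · exact ⟨fun _ => univ, fun _ => ⟨fun _ => univ, fun i _ => MeasurableSet.univ, by simp⟩,
      fun _ => measure_lt_top _ _, iUnion_const _⟩
  · choose t ht hts using hs
    have hm : ∀ j i, MeasurableSet (t j i) := fun j i => ht j i (mem_univ i)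
    have hs' : s = fun j => univ.pi (t j) := funext fun j => (hts j).symm
    subst hs'
    rw [Measure.map_apply (measurable_shuffle e)
      (MeasurableSet.univ_pi fun j => MeasurableSet.univ_pi (hm j))]
    have hset : shuffle e ⁻¹' (univ.pi fun j => univ.pi (t j))
        = univ.pi fun k => univ.pi fun i => t ((e i).symm k) i := by
      ext y
      simp only [mem_preimage, mem_univ_pi, shuffle]
      constructor
      · intro h k i
        simpa using h ((e i).symm k) i
      · intro h j i
        simpa using h (e i j) i
    rw [hset, Measure.pi_pi]
    simp_rw [Measure.pi_pi]
    rw [Finset.prod_comm, Finset.prod_comm (f := fun j i => ν i (t j i))]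
    exact Finset.prod_congr rfl fun i _ => Equiv.prod_comp (e i).symm fun j => ν i (t j i)

end Shuffle

section Cyclic

theorem integrable_and_integral_sum_map {ι Θ F : Type*} [Fintype ι] [MeasurableSpace Θ]
    [MeasurableSpace F] {κ : Measure Θ} {w : ι → Θ → F} (hw : ∀ j, Measurable (w j)) {g : F → ℝ}
    (hg : Measurable g) (hint : Integrable g (∑ j, κ.map (w j))) :
    Integrable (fun θ => ∑ j, g (w j θ)) κ ∧
      ∫ x, g x ∂(∑ j, κ.map (w j)) = ∫ θ, ∑ j, g (w j θ) ∂κ := by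
  rw [integrable_finsetSum_measure] at hint
  have hj : ∀ j, Integrable (fun θ => g (w j θ)) κ := fun j =>
    (hint j (Finset.mem_univ j)).comp_measurable (hw j)
  refine ⟨integrable_finsetSum _ fun j _ => hj j, ?_⟩
  rw [integral_finsetSum_measure hint, integral_finsetSum _ fun j _ => hj j]
  exact Finset.sum_congr rfl fun j _ =>
    integral_map (hw j).aemeasurable hg.aestronglyMeasurable

theorem sum_map_apply {ι Θ F : Type*} [Fintype ι] [MeasurableSpace Θ] [MeasurableSpace F]
    {κ : Measure Θ} {w : ι → Θ → F} (hw : ∀ j, Measurable (w j)) {A : Set F}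
    (hA : MeasurableSet A) : (∑ j, κ.map (w j)) A = ∑ j, κ (w j ⁻¹' A) := by
  rw [Measure.finsetSum_apply]
  exact Finset.sum_congr rfl fun j _ => Measure.map_apply (hw j) hA

variable {ι E : Type*} [Fintype ι] [Nonempty ι] [MeasurableSpace E] {R : Measure (ι → E)}
  [SigmaFinite R] {C : Measure (ι → E) → Prop} {ρ : (ι → E) → ℝ}

/-- The cyclical monotonicity of a density `ρ` of minimal entropy, for constraints that only
concern the marginals: shuffling independent rows of law `ρ R` does not decrease the product of
the values of `ρ`. Otherwise, moving mass from the rows to the shuffled rows decreases the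
entropy. -/
theorem IsMinDensity.prod_le_prod_shuffle (h : IsMinDensity R C ρ) {P : Measure (ι → E)}
    [IsProbabilityMeasure P] (hP : P = R.withDensity fun x => ENNReal.ofReal (ρ x))
    (hC : ∀ Q : Measure (ι → E), (∀ i, Q.map (fun x => x i) = P.map fun x => x i) → C Q)
    (hν : (Measure.pi fun i => P.map fun x => x i) ≪ R) (e : ι → Equiv.Perm ι)
    (he : ∀ j, Function.Injective fun i => e i j) :
    ∀ᵐ y ∂(Measure.pi fun _ : ι => P), ∏ j, ρ (y j) ≤ ∏ j, ρ (shuffle e y j) := by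
  have hprob : ∀ i : ι, IsProbabilityMeasure (P.map fun x => x i) := fun i =>
    Measure.isProbabilityMeasure_map (measurable_pi_apply i).aemeasurable
  have hPR : P ≪ R := hP ▸ withDensity_absolutelyContinuous _ _
  have hρ0 := h.nonneg
  set ν := Measure.pi fun i => P.map fun x => x i with hνdef
  set Pm := Measure.pi fun _ : ι => P with hPm
  have hz : ∀ j, Measurable fun y : ι → ι → E => shuffle e y j := fun j =>
    (measurable_pi_apply j).comp (measurable_shuffle e)
  have hy : ∀ j, Measurable fun y : ι → ι → E => y j := fun j => measurable_pi_apply j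
  have lawz : ∀ j, Pm.map (fun y => shuffle e y j) = ν := fun j => map_shuffle_row e j (he j) P
  have lawy : ∀ j, Pm.map (fun y => y j) = P := fun j =>
    (measurePreserving_eval (fun _ : ι => P) j).map_eq
  let v := ν.rnDeriv R
  have hvm : Measurable v := Measure.measurable_rnDeriv ν R
  have hvfin : ∀ᵐ x ∂ R, v x < ∞ := Measure.rnDeriv_lt_top ν R
  -- The good sets `S n`, on which the first variation inequality applies, exhaust the space.
  let S : ℕ → Set (ι → E) := fun n =>
    spanningSets R n ∩ {x | ρ x ≤ n + 1} ∩ {x | v x ≤ ENNReal.ofReal (n + 1)}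
  have hSm : ∀ n, MeasurableSet (S n) := fun n =>
    ((measurableSet_spanningSets R n).inter
      (measurableSet_le h.measurable measurable_const)).inter
      (measurableSet_le hvm measurable_const)
  have hSR : ∀ n, R (S n) ≠ ∞ := fun n =>
    ((measure_mono fun x hx => hx.1.1).trans_lt (measure_spanningSets_lt_top R n)).ne
  have hSev : ∀ x, v x < ∞ → ∀ᶠ n in Filter.atTop, x ∈ S n := by
    intro x hx
    have h1 : ∀ᶠ n in Filter.atTop, x ∈ spanningSets R n := by
      filter_upwards [Filter.eventually_ge_atTop (spanningSetsIndex R x)] with n hn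
      exact monotone_spanningSets R hn (mem_spanningSetsIndex R x)
    have h2 : ∀ᶠ n : ℕ in Filter.atTop, ρ x ≤ n + 1 := by
      filter_upwards [Filter.eventually_ge_atTop ⌈ρ x⌉₊] with n hn
      have : (⌈ρ x⌉₊ : ℝ) ≤ n := by exact_mod_cast hn
      linarith [Nat.le_ceil (ρ x)]
    have h3 : ∀ᶠ n : ℕ in Filter.atTop, v x ≤ ENNReal.ofReal (n + 1) := by
      filter_upwards [Filter.eventually_ge_atTop ⌈(v x).toReal⌉₊] with n hn
      have : (⌈(v x).toReal⌉₊ : ℝ) ≤ n := by exact_mod_cast hn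
      rw [← ENNReal.ofReal_toReal hx.ne]
      exact ENNReal.ofReal_le_ofReal (by linarith [Nat.le_ceil (v x).toReal])
    filter_upwards [h1, h2, h3] with n a b c using ⟨⟨a, b⟩, c⟩
  let δ : ℕ → ℝ := fun n => 1 / ((n : ℝ) + 2)
  have hδ0 : ∀ n, 0 < δ n := fun n => by positivity
  have hδ1 : ∀ n, δ n < 1 := fun n => by
    simp only [δ]
    rw [div_lt_one (by positivity)]
    linarith [(Nat.cast_nonneg n : (0 : ℝ) ≤ n)]
  have hδlim : Filter.Tendsto δ Filter.atTop (nhds 0) := by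
    refine Filter.Tendsto.div_atTop tendsto_const_nhds ?_
    exact Filter.tendsto_atTop_add_const_right _ _ tendsto_natCast_atTop_atTop
  -- An array for which the inequality fails is almost surely in some `B n`. The first variation
  -- inequality for the rows and the shuffled rows of the arrays in `B n` shows that `B n` is null.
  let B : ℕ → Set (ι → ι → E) := fun n =>
    {y | (∀ j, y j ∈ S n) ∧ (∀ j, shuffle e y j ∈ S n) ∧
      ∏ j, (ρ (shuffle e y j) + δ n) < ∏ j, ((1 - δ n) * ρ (y j))}
  have hBm : ∀ n, MeasurableSet (B n) := by
    intro n
    have m1 : Measurable fun y : ι → ι → E => ∏ j, (ρ (shuffle e y j) + δ n) :=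
      Finset.measurable_prod _ fun j _ => (h.measurable.comp (hz j)).add_const _
    have m2 : Measurable fun y : ι → ι → E => ∏ j, ((1 - δ n) * ρ (y j)) :=
      Finset.measurable_prod _ fun j _ => (h.measurable.comp (hy j)).const_mul _
    have m3 : MeasurableSet {y : ι → ι → E | ∀ j, y j ∈ S n} := by
      simp only [ofPred_forall]
      exact MeasurableSet.iInter fun j => hy j (hSm n)
    have m4 : MeasurableSet {y : ι → ι → E | ∀ j, shuffle e y j ∈ S n} := by
      simp only [ofPred_forall]
      exact MeasurableSet.iInter fun j => hz j (hSm n)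
    exact m3.inter (m4.inter (measurableSet_lt m1 m2))
  have hBnull : ∀ n, Pm (B n) = 0 := by
    intro n
    set κ := Pm.restrict (B n) with hκ
    have hn1 : (1 : ℝ) ≤ n + 1 := by linarith [(Nat.cast_nonneg n : (0 : ℝ) ≤ n)]
    have hcard : (1 : ℝ) ≤ Fintype.card ι := by exact_mod_cast Fintype.card_pos (α := ι)
    set M : ℝ := Fintype.card ι * (n + 1) with hM
    have hM1 : 1 ≤ M := by nlinarith
    have hM2 : (n : ℝ) + 1 ≤ M := by nlinarith
    have hM3 : (Fintype.card ι : ℝ) ≤ M := by nlinarith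
    have hz1 : (∑ j, κ.map fun y => shuffle e y j)
        ≤ R.withDensity fun _ => ENNReal.ofReal M := by
      refine Measure.le_iff.2 fun A hA => ?_
      rw [sum_map_apply hz hA, withDensity_apply _ hA, setLIntegral_const]
      calc ∑ j, κ ((fun y => shuffle e y j) ⁻¹' A)
          ≤ ∑ _j : ι, ENNReal.ofReal (n + 1) * R A := by
            refine Finset.sum_le_sum fun j _ => ?_
            rw [hκ, Measure.restrict_apply (hz j hA)]
            calc Pm ((fun y => shuffle e y j) ⁻¹' A ∩ B n)
                ≤ Pm ((fun y => shuffle e y j) ⁻¹' (A ∩ S n)) :=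
                  measure_mono fun y hy => ⟨hy.1, hy.2.2.1 j⟩
              _ = ν (A ∩ S n) := by
                  rw [← lawz j, Measure.map_apply (hz j) (hA.inter (hSm n))]
              _ = ∫⁻ x in A ∩ S n, v x ∂ R := (Measure.setLIntegral_rnDeriv hν _).symm
              _ ≤ ∫⁻ x in A ∩ S n, ENNReal.ofReal (n + 1) ∂ R :=
                  setLIntegral_mono measurable_const fun x hx => hx.2.2
              _ = ENNReal.ofReal (n + 1) * R (A ∩ S n) := setLIntegral_const _ _
              _ ≤ ENNReal.ofReal (n + 1) * R A := by gcongr; exact inter_subset_left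
        _ = ENNReal.ofReal M * R A := by
            rw [Finset.sum_const, Finset.card_univ, nsmul_eq_mul, ← mul_assoc, hM,
              ENNReal.ofReal_mul (Nat.cast_nonneg _), ENNReal.ofReal_natCast]
    have hy1 : (∑ j, κ.map fun y => y j)
        ≤ R.withDensity fun x => ENNReal.ofReal (M * ρ x) := by
      refine Measure.le_iff.2 fun A hA => ?_
      rw [sum_map_apply hy hA, withDensity_apply _ hA]
      calc ∑ j, κ ((fun y : ι → ι → E => y j) ⁻¹' A)
          ≤ ∑ _j : ι, P A := by
            refine Finset.sum_le_sum fun j _ => ?_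
            rw [← lawy j, Measure.map_apply (hy j) hA]
            exact Measure.restrict_apply_le _ _
        _ = ENNReal.ofReal (Fintype.card ι) * P A := by
            rw [Finset.sum_const, Finset.card_univ, nsmul_eq_mul, ENNReal.ofReal_natCast]
        _ ≤ ENNReal.ofReal M * P A := by gcongr
        _ = ∫⁻ x in A, ENNReal.ofReal (M * ρ x) ∂ R := by
            rw [hP, withDensity_apply _ hA, ← lintegral_const_mul _ h.measurable.ennreal_ofReal]
            simp_rw [ENNReal.ofReal_mul (zero_le_one.trans hM1)]
    have hzS : (∑ j, κ.map fun y => shuffle e y j) (S n)ᶜ = 0 := by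
      rw [sum_map_apply hz (hSm n).compl]
      refine Finset.sum_eq_zero fun j _ => ?_
      rw [hκ, Measure.restrict_apply (hz j (hSm n).compl)]
      exact measure_mono_null (fun y hy => (hy.1 (hy.2.2.1 j)).elim) measure_empty
    have hyS : (∑ j, κ.map fun y => y j) (S n)ᶜ = 0 := by
      rw [sum_map_apply hy (hSm n).compl]
      refine Finset.sum_eq_zero fun j _ => ?_
      rw [hκ, Measure.restrict_apply (hy j (hSm n).compl)]
      exact measure_mono_null (fun y hy => (hy.1 (hy.2.1 j)).elim) measure_empty
    have hmarg : ∀ i, (∑ j, κ.map fun y => shuffle e y j).map (fun x => x i)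
        = (∑ j, κ.map fun y => y j).map fun x => x i := by
      intro i
      ext A hA
      rw [Measure.map_apply (measurable_pi_apply i) hA,
        Measure.map_apply (measurable_pi_apply i) hA, sum_map_apply hz (measurable_pi_apply i hA),
        sum_map_apply hy (measurable_pi_apply i hA)]
      exact Equiv.sum_comp (e i) fun j => κ ((fun y : ι → ι → E => y j) ⁻¹'
        ((fun x : ι → E => x i) ⁻¹' A))
    have hmass : (∑ j, κ.map fun y => shuffle e y j) univ = (∑ j, κ.map fun y => y j) univ := by
      rw [sum_map_apply hz MeasurableSet.univ, sum_map_apply hy MeasurableSet.univ]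
      simp
    obtain ⟨I1, I2, hle⟩ := h.integral_log_le (fun i => measurable_pi_apply i)
      (fun Q hQ => hC Q fun i => hP ▸ hQ i) hM1 hz1 hy1 (hSm n) (hSR n)
      (fun x hx => hx.1.2.trans hM2) hzS hyS hmarg hmass (hδ0 n) (hδ1 n)
    obtain ⟨J1, e1⟩ := integrable_and_integral_sum_map hz
      (Real.measurable_log.comp (h.measurable.add_const (δ n))) I1
    obtain ⟨J2, e2⟩ := integrable_and_integral_sum_map hy
      (Real.measurable_log.comp (h.measurable.const_mul (1 - δ n))) I2
    simp only [Function.comp_def] at J1 J2 e1 e2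
    rw [e1, e2] at hle
    -- On `B n` the two integrands are strictly ordered the other way.
    have hlt : ∀ y ∈ B n, ∑ j, Real.log (ρ (shuffle e y j) + δ n)
        < ∑ j, Real.log ((1 - δ n) * ρ (y j)) := by
      intro y hyB
      have p1 : ∀ j, 0 < ρ (shuffle e y j) + δ n := fun j =>
        add_pos_of_nonneg_of_pos (hρ0 _) (hδ0 n)
      have p0 : 0 < ∏ j, (ρ (shuffle e y j) + δ n) := Finset.prod_pos fun j _ => p1 j
      have p2 := (p0.trans hyB.2.2).ne'
      rw [Finset.prod_ne_zero_iff] at p2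
      rw [← Real.log_prod fun j _ => (p1 j).ne', ← Real.log_prod p2]
      exact Real.log_lt_log p0 hyB.2.2
    have hlt' : ∀ᵐ y ∂κ, 0 < ∑ j, Real.log ((1 - δ n) * ρ (y j))
        - ∑ j, Real.log (ρ (shuffle e y j) + δ n) :=
      (ae_restrict_iff' (hBm n)).2 (Filter.Eventually.of_forall fun y hyB => sub_pos.2 (hlt y hyB))
    have hzero : ∫ y, (∑ j, Real.log ((1 - δ n) * ρ (y j))
        - ∑ j, Real.log (ρ (shuffle e y j) + δ n)) ∂κ = 0 := by
      refine le_antisymm ?_ (integral_nonneg_of_ae (hlt'.mono fun y hy => hy.le))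
      rw [integral_sub J2 J1]
      linarith
    rw [integral_eq_zero_iff_of_nonneg_ae (hlt'.mono fun y hy => hy.le) (J2.sub J1)] at hzero
    have hfalse : ∀ᵐ y ∂κ, False := by
      filter_upwards [hlt', hzero] with y h1 h2
      exact h1.ne' h2
    have : κ = 0 := ae_eq_bot.1 (Filter.eventually_false_iff_eq_bot.1 hfalse)
    rwa [hκ, Measure.restrict_eq_zero] at this
  have hyfin : ∀ᵐ y ∂Pm, ∀ j, v (y j) < ∞ := by
    rw [ae_all_iff]
    intro j
    have := hPR.ae_le hvfin
    rw [← lawy j] at this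
    exact ae_of_ae_map (hy j).aemeasurable this
  have hzfin : ∀ᵐ y ∂Pm, ∀ j, v (shuffle e y j) < ∞ := by
    rw [ae_all_iff]
    intro j
    have := hν.ae_le hvfin
    rw [← lawz j] at this
    exact ae_of_ae_map (hz j).aemeasurable this
  have hnot : ∀ᵐ y ∂Pm, ∀ n, y ∉ B n :=
    ae_all_iff.2 fun n => measure_eq_zero_iff_ae_notMem.1 (hBnull n)
  filter_upwards [hyfin, hzfin, hnot] with y h1 h2 h3
  by_contra hlt
  rw [not_le] at hlt
  have l1 : Filter.Tendsto (fun n => ∏ j, (ρ (shuffle e y j) + δ n)) Filter.atTop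
      (nhds (∏ j, (ρ (shuffle e y j) + 0))) :=
    tendsto_finsetProd _ fun j _ => tendsto_const_nhds.add hδlim
  have l2 : Filter.Tendsto (fun n => ∏ j, ((1 - δ n) * ρ (y j))) Filter.atTop
      (nhds (∏ j, ((1 - 0) * ρ (y j)))) :=
    tendsto_finsetProd _ fun j _ => (tendsto_const_nhds.sub hδlim).mul tendsto_const_nhds
  have hev := l1.eventually_lt l2 (by simpa using hlt)
  have ev1 : ∀ᶠ n in Filter.atTop, ∀ j, y j ∈ S n := Filter.eventually_all.2 fun j => hSev _ (h1 j)
  have ev2 : ∀ᶠ n in Filter.atTop, ∀ j, shuffle e y j ∈ S n :=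
    Filter.eventually_all.2 fun j => hSev _ (h2 j)
  obtain ⟨n, a, b, c⟩ := (ev1.and (ev2.and hev)).exists
  exact h3 n ⟨a, b, c⟩

end Cyclic

/-! ### Factorization of minimal densities on product spaces -/

section PiDensity

variable {E : Type*} [MeasurableSpace E]

theorem piFinSuccAbove_symm_zero {n : ℕ} (x : E) (w : Fin n → E) :
    (MeasurableEquiv.piFinSuccAbove (fun _ : Fin (n + 1) => E) 0).symm (x, w)
      = (Fin.cons x w : Fin (n + 1) → E) :=
  Fin.insertNth_zero' x w

theorem lintegral_pi_prod {n : ℕ} (μ : Fin n → Measure E) [∀ i, SigmaFinite (μ i)]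
    {f : Fin n → E → ℝ≥0∞} (hf : ∀ i, Measurable (f i)) :
    ∫⁻ x, ∏ i, f i (x i) ∂(Measure.pi μ) = ∏ i, ∫⁻ a, f i a ∂(μ i) := by
  induction n with
  | zero => simp
  | succ n ih =>
    have hmp := (measurePreserving_piFinSuccAbove μ 0).symm
    rw [← hmp.lintegral_comp_emb (MeasurableEquiv.measurableEmbedding _)]
    have hm : Measurable fun w : Fin n → E => ∏ i, f (Fin.succ i) (w i) :=
      Finset.measurable_prod _ fun i _ => (hf _).comp (measurable_pi_apply i)
    have hpt : ∀ z : E × (Fin n → E),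
        ∏ i, f i ((MeasurableEquiv.piFinSuccAbove (fun _ : Fin (n + 1) => E) 0).symm z i)
          = f 0 z.1 * ∏ i, f (Fin.succ i) (z.2 i) := by
      rintro ⟨x, w⟩
      simp [piFinSuccAbove_symm_zero, Fin.prod_univ_succ]
    simp_rw [hpt]
    simp only [Fin.prod_univ_succ, Fin.zero_succAbove]
    rw [lintegral_prod_mul (hf 0).aemeasurable hm.aemeasurable,
      ih (fun i => μ i.succ) fun i => hf i.succ]

theorem pi_withDensity {n : ℕ} (μ : Fin n → Measure E) [∀ i, SigmaFinite (μ i)]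
    {f : Fin n → E → ℝ≥0∞} (hf : ∀ i, Measurable (f i))
    [∀ i, SigmaFinite ((μ i).withDensity (f i))] :
    Measure.pi (fun i => (μ i).withDensity (f i))
      = (Measure.pi μ).withDensity fun x => ∏ i, f i (x i) := by
  refine Measure.pi_eq fun s hs => ?_
  rw [withDensity_apply _ (MeasurableSet.univ_pi hs),
    ← lintegral_indicator (MeasurableSet.univ_pi hs)]
  have : ∀ x : Fin n → E, (univ.pi s).indicator (fun x => ∏ i, f i (x i)) x
      = ∏ i, (s i).indicator (f i) (x i) := by
    intro x
    by_cases hx : x ∈ univ.pi s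
    · rw [indicator_of_mem hx]
      exact Finset.prod_congr rfl fun i _ => (indicator_of_mem (hx i (mem_univ i)) _).symm
    · rw [indicator_of_notMem hx]
      simp only [mem_univ_pi, not_forall] at hx
      obtain ⟨i, hi⟩ := hx
      exact (Finset.prod_eq_zero (Finset.mem_univ i) (indicator_of_notMem hi _)).symm
  simp_rw [this]
  rw [lintegral_pi_prod μ fun i => (hf i).indicator (hs i)]
  exact Finset.prod_congr rfl fun i _ => by
    rw [lintegral_indicator (hs i), withDensity_apply _ (hs i)]

theorem pi_eq_withDensity_rnDeriv {n : ℕ} {μ ν : Fin n → Measure E} [∀ i, SigmaFinite (μ i)]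
    [∀ i, SigmaFinite (ν i)] (h : ∀ i, μ i ≪ ν i) :
    Measure.pi μ = (Measure.pi ν).withDensity fun x => ∏ i, (μ i).rnDeriv (ν i) (x i) := by
  have hw : ∀ i, (ν i).withDensity ((μ i).rnDeriv (ν i)) = μ i := fun i =>
    Measure.withDensity_rnDeriv_eq _ _ (h i)
  have : ∀ i, SigmaFinite ((ν i).withDensity ((μ i).rnDeriv (ν i))) := fun i => by
    rw [hw i]; infer_instance
  rw [← pi_withDensity ν fun i => Measure.measurable_rnDeriv _ _]
  simp_rw [hw]

theorem absolutelyContinuous_pi {n : ℕ} {μ ν : Fin n → Measure E} [∀ i, SigmaFinite (μ i)]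
    [∀ i, SigmaFinite (ν i)] (h : ∀ i, μ i ≪ ν i) : Measure.pi μ ≪ Measure.pi ν := by
  rw [pi_eq_withDensity_rnDeriv h]
  exact withDensity_absolutelyContinuous _ _

end PiDensity

section Factorization

variable {E : Type*} [MeasurableSpace E] {n : ℕ} {R : Measure (Fin (n + 1) → E)} [SigmaFinite R]
  {C : Measure (Fin (n + 1) → E) → Prop} {ρ : (Fin (n + 1) → E) → ℝ}

/-- If the reference measure is equivalent to the product of its marginals and the constraints only
concern the marginals, then a density of minimal entropy is a product of functions of one
coordinate. The cyclical monotonicity is an equality, since shuffling can be undone by shuffling;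
fixing all rows but one in this equality gives the product. -/
theorem IsMinDensity.exists_eq_prod (h : IsMinDensity R C ρ)
    [∀ i, SigmaFinite (R.map fun x => x i)]
    (hC : ∀ Q : Measure (Fin (n + 1) → E), (∀ i, Q.map (fun x => x i)
      = (R.withDensity fun x => ENNReal.ofReal (ρ x)).map fun x => x i) → C Q)
    (hR : R ≪ Measure.pi fun i => R.map fun x => x i)
    (hR' : (Measure.pi fun i => R.map fun x => x i) ≪ R) :
    ∃ g : Fin (n + 1) → E → ℝ≥0∞, (∀ i, Measurable (g i)) ∧ (∀ i a, g i a ≠ ∞) ∧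
      ∀ᵐ x ∂ R, ENNReal.ofReal (ρ x) = ∏ i, g i (x i) := by
  have hρm := h.measurable
  have hρ0 := h.nonneg
  set P := R.withDensity fun x => ENNReal.ofReal (ρ x) with hP
  have hPprob : IsProbabilityMeasure P :=
    ⟨by rw [hP, withDensity_apply _ MeasurableSet.univ, setLIntegral_univ, h.lintegral_eq_one]⟩
  have hPR : P ≪ R := withDensity_absolutelyContinuous _ _
  have hprob : ∀ i : Fin (n + 1), IsProbabilityMeasure (P.map fun x => x i) := fun i =>
    Measure.isProbabilityMeasure_map (measurable_pi_apply i).aemeasurable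
  have hPRi : ∀ i, (P.map fun x => x i) ≪ R.map fun x => x i := fun i =>
    hPR.map (measurable_pi_apply i)
  let p : Fin (n + 1) → E → ℝ≥0∞ := fun i => (P.map fun x => x i).rnDeriv (R.map fun x => x i)
  have hpm : ∀ i, Measurable (p i) := fun i => Measure.measurable_rnDeriv _ _
  set ν := Measure.pi fun i => P.map fun x => x i with hνdef
  have hνdens : ν = (Measure.pi fun i => R.map fun x => x i).withDensity
      fun x => ∏ i, p i (x i) := pi_eq_withDensity_rnDeriv hPRi
  have hνR : ν ≪ R := (absolutelyContinuous_pi hPRi).trans hR'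
  -- On the set where all marginal densities are positive, `R` is dominated by `ν`.
  have hRν : ∀ {q : (Fin (n + 1) → E) → Prop}, (∀ᵐ x ∂ν, q x) →
      ∀ᵐ x ∂ R, (∀ i, p i (x i) ≠ 0) → q x := by
    intro q hq
    have hprodm : Measurable fun x : Fin (n + 1) → E => ∏ i, p i (x i) :=
      Finset.measurable_prod _ fun i _ => (hpm i).comp (measurable_pi_apply i)
    rw [hνdens, ae_withDensity_iff hprodm] at hq
    filter_upwards [hR.ae_le hq] with x hx hne
    exact hx (Finset.prod_ne_zero_iff.2 fun i _ => hne i)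
  have hρG : ∀ᵐ x ∂ R, ρ x ≠ 0 → ∀ i, p i (x i) ≠ 0 := by
    have hPp : ∀ᵐ x ∂P, ∀ i, p i (x i) ≠ 0 := by
      rw [ae_all_iff]
      intro i
      have := Measure.rnDeriv_pos (hPRi i)
      exact (ae_of_ae_map (measurable_pi_apply i).aemeasurable this).mono fun x hx => hx.ne'
    rw [hP, ae_withDensity_iff hρm.ennreal_ofReal] at hPp
    filter_upwards [hPp] with x hx hne
    exact hx (by simpa using lt_of_le_of_ne (hρ0 x) (Ne.symm hne))
  have hPpos : ∀ᵐ x ∂P, 0 < ρ x := by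
    rw [hP, ae_withDensity_iff hρm.ennreal_ofReal]
    exact Filter.Eventually.of_forall fun x hx => by simpa using hx
  -- The cyclic shifts: the `j`-th shuffled row takes its `i`-th coordinate from the row `j + i`.
  let e : Fin (n + 1) → Equiv.Perm (Fin (n + 1)) := fun i => Equiv.addRight i
  let e' : Fin (n + 1) → Equiv.Perm (Fin (n + 1)) := fun i => (e i).symm
  have he : ∀ j, Function.Injective fun i => e i j := fun j a b hab => by
    simpa [e] using hab
  have he' : ∀ j, Function.Injective fun i => e' i j := fun j a b hab => by
    simpa [e', e, Equiv.addRight] using hab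
  have hz : ∀ j, Measurable fun y : Fin (n + 1) → Fin (n + 1) → E => shuffle e y j := fun j =>
    (measurable_pi_apply j).comp (measurable_shuffle e)
  have key := h.prod_le_prod_shuffle hP hC hνR e he
  have key' := h.prod_le_prod_shuffle hP hC hνR e' he'
  -- The density is positive on the product of the marginals of `P`.
  have hνpos : ∀ᵐ x ∂ν, 0 < ρ x := by
    have hrows : ∀ᵐ y ∂(Measure.pi fun _ : Fin (n + 1) => P), ∀ j, 0 < ρ (y j) := by
      rw [ae_all_iff]
      intro j
      have := hPpos
      rw [← (measurePreserving_eval (fun _ : Fin (n + 1) => P) j).map_eq] at this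
      exact ae_of_ae_map (measurable_pi_apply j).aemeasurable this
    rw [hνdef, ← map_shuffle_row e 0 (he 0) P,
      ae_map_iff (hz 0).aemeasurable (measurableSet_lt measurable_const hρm)]
    filter_upwards [hrows, key] with y h1 h2
    have h3 := (Finset.prod_pos fun j _ => h1 j).trans_le h2
    exact lt_of_le_of_ne (hρ0 _)
      (Ne.symm (Finset.prod_ne_zero_iff.1 h3.ne' 0 (Finset.mem_univ _)))
  have hνP : ν ≪ P := by
    refine Measure.AbsolutelyContinuous.mk fun A hA hPA => ?_
    have h1 : ∀ᵐ x ∂P, x ∉ A := measure_eq_zero_iff_ae_notMem.1 hPA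
    rw [hP, ae_withDensity_iff hρm.ennreal_ofReal] at h1
    refine measure_eq_zero_iff_ae_notMem.2 ?_
    filter_upwards [hνR.ae_le h1, hνpos] with x hx hx0
    exact hx (by simpa using hx0)
  have hνPm : (Measure.pi fun _ : Fin (n + 1) => ν) ≪ Measure.pi fun _ : Fin (n + 1) => P :=
    absolutelyContinuous_pi fun _ => hνP
  -- Shuffling by `e` and then by `e'` gives the array back, so that the two inequalities are one
  -- equality. The second one may be used at a shuffled array, because all entries are independent
  -- under the product of the marginals.
  have heq : ∀ᵐ y ∂(Measure.pi fun _ : Fin (n + 1) => ν),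
      ∏ j, ρ (y j) = ∏ j, ρ (shuffle e y j) := by
    have h1 := hνPm.ae_le key
    have h2 := (measurePreserving_shuffle e
      fun i => P.map fun x : Fin (n + 1) → E => x i).quasiMeasurePreserving.ae (hνPm.ae_le key')
    filter_upwards [h1, h2] with y a b
    rw [shuffle_shuffle_symm] at b
    exact le_antisymm a b
  have hpos : ∀ᵐ y ∂(Measure.pi fun _ : Fin (n + 1) => ν), ∀ j, 0 < ρ (y j) := by
    rw [ae_all_iff]
    intro j
    exact (Measure.quasiMeasurePreserving_eval (fun _ : Fin (n + 1) => ν) j).ae hνpos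
  -- All rows but the first one are fixed.
  obtain ⟨w, hw⟩ : ∃ w : Fin n → Fin (n + 1) → E, ∀ᵐ x ∂ν,
      (ρ x * ∏ k, ρ (w k) = ∏ j, ρ (shuffle e (Fin.cons x w) j)) ∧ ∀ k, 0 < ρ (w k) := by
    have hmp := ((measurePreserving_piFinSuccAbove (fun _ : Fin (n + 1) => ν) 0).symm).comp
      (Measure.measurePreserving_swap (μ := Measure.pi fun _ : Fin n => ν) (ν := ν))
    have hae := Measure.ae_ae_of_ae_prod (hmp.quasiMeasurePreserving.ae (heq.and hpos))
    obtain ⟨w, hw⟩ := hae.exists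
    refine ⟨w, hw.mono fun x hx => ?_⟩
    simp only [Function.comp_apply, Prod.swap_prod_mk, piFinSuccAbove_symm_zero] at hx
    rw [Fin.prod_univ_succ] at hx
    exact ⟨by simpa using hx.1, fun k => by simpa using hx.2 k.succ⟩
  -- Each shuffled row contains exactly one coordinate of the first row: the row `-i` contains the
  -- `i`-th one.
  have hrow : ∀ (x : Fin (n + 1) → E) (i : Fin (n + 1)),
      shuffle e (Fin.cons x w) (-i) = shuffle e (Fin.cons (fun _ => x i) w) (-i) := by
    intro x i
    ext k
    simp only [shuffle, e, Equiv.coe_addRight]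
    by_cases hk : -i + k = 0
    · have : k = i := by rwa [neg_add_eq_zero, eq_comm] at hk
      subst this
      simp [hk]
    · obtain ⟨l, hl⟩ := Fin.exists_succ_eq.2 hk
      rw [← hl, Fin.cons_succ, Fin.cons_succ]
  have hwpos : ∀ k, 0 < ρ (w k) := hw.exists.choose_spec.2
  let c : ℝ := ∏ k, ρ (w k)
  have hc : 0 < c := Finset.prod_pos fun k _ => hwpos k
  -- The constant `c` is attributed to the factor of index `0`.
  let γ : Fin (n + 1) → E → ℝ := fun i a =>
    ρ (shuffle e (Fin.cons (fun _ => a) w) (-i)) * (if i = 0 then c⁻¹ else 1)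
  have hγm : ∀ i, Measurable (γ i) := by
    intro i
    refine Measurable.mul_const (hρm.comp (measurable_pi_lambda _ fun k => ?_)) _
    simp only [shuffle]
    refine Fin.cases ?_ (fun l => ?_) (e k (-i))
    · simpa using measurable_id'
    · simp
  have hγ0 : ∀ i a, 0 ≤ γ i a := fun i a =>
    mul_nonneg (hρ0 _) (by split_ifs; exacts [(inv_pos.2 hc).le, zero_le_one])
  have hργ : ∀ᵐ x ∂ν, ρ x = ∏ i, γ i (x i) := by
    filter_upwards [hw] with x hx
    have h1 : ∏ i, γ i (x i) = (∏ i, ρ (shuffle e (Fin.cons x w) (-i))) * c⁻¹ := by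
      simp only [γ]
      rw [Finset.prod_mul_distrib, Finset.prod_ite_eq' Finset.univ (0 : Fin (n + 1))]
      simp only [Finset.mem_univ, if_true]
      congr 1
      exact Finset.prod_congr rfl fun i _ => by rw [hrow x i]
    have h2 : ∏ i, ρ (shuffle e (Fin.cons x w) (-i)) = ∏ j, ρ (shuffle e (Fin.cons x w) j) :=
      Equiv.prod_comp (Equiv.neg _) fun j => ρ (shuffle e (Fin.cons x w) j)
    rw [h1, h2, ← hx.1, mul_assoc, mul_inv_cancel₀ hc.ne', mul_one]
  -- Where some marginal density vanishes, `ρ` vanishes, and so has to do the product.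
  refine ⟨fun i => {a | p i a ≠ 0}.indicator fun a => ENNReal.ofReal (γ i a),
    fun i => (hγm i).ennreal_ofReal.indicator (hpm i (measurableSet_singleton 0)).compl,
    fun i a => ?_, ?_⟩
  · by_cases ha : a ∈ {a | p i a ≠ 0}
    · simp only [indicator_of_mem ha]; exact ENNReal.ofReal_ne_top
    · simp only [indicator_of_notMem ha]; exact ENNReal.zero_ne_top
  · filter_upwards [hRν hργ, hρG] with x h1 h2
    by_cases hx : ∀ i, p i (x i) ≠ 0
    · rw [h1 hx, ENNReal.ofReal_prod_of_nonneg fun i _ => hγ0 i _]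
      exact Finset.prod_congr rfl fun i _ => (indicator_of_mem
        (s := {a | p i a ≠ 0}) (hx i) fun a => ENNReal.ofReal (γ i a)).symm
    · have h0 : ρ x = 0 := by
        by_contra hne
        exact hx (h2 hne)
      rw [not_forall] at hx
      obtain ⟨i, hi⟩ := hx
      rw [h0, ENNReal.ofReal_zero]
      exact (Finset.prod_eq_zero (Finset.mem_univ i) (indicator_of_notMem
        (s := {a | p i a ≠ 0}) hi fun a => ENNReal.ofReal (γ i a))).symm

end Factorization

/-! ### The state of an irreducible reciprocal measure at one time -/

section CondIndepProd

theorem measurable_indicator_one {Ω : Type*} {m : MeasurableSpace Ω} {s : Set Ω}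
    (hs : MeasurableSet s) : Measurable (s.indicator (1 : Ω → ℝ≥0∞)) :=
  measurable_one.indicator hs

variable {Ω E F G : Type*} [MeasurableSpace E] [MeasurableSpace F] [MeasurableSpace G]
  {𝒜 ℬ m0 : MeasurableSpace Ω} {R : Measure[m0] Ω}

theorem sigmaFinite_trim_congr {Ω : Type*} {m m' m0 : MeasurableSpace Ω} {R : Measure[m0] Ω}
    (h : m = m') (hm : m ≤ m0) (hm' : m' ≤ m0) [SigmaFinite (R.trim hm)] :
    SigmaFinite (R.trim hm') := by
  subst h
  assumption

/-- The joint law of `V` and `X` is the image under `V × id` of any measure that gives the right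
mass to rectangles. -/
theorem map_prodMk_eq_of_rect {V : Ω → E} {X : Ω → G} (hV : Measurable V) (hX : Measurable X)
    [hσ : SigmaFinite (R.map V)] {κ : Measure (Ω × G)}
    (h : ∀ A B, MeasurableSet A → MeasurableSet B →
      R (V ⁻¹' A ∩ X ⁻¹' B) = κ ((V ⁻¹' A) ×ˢ B)) :
    R.map (fun ω => (V ω, X ω)) = κ.map (Prod.map V id) := by
  have hVX : Measurable fun ω => (V ω, X ω) := hV.prodMk hX
  have hVid : Measurable (Prod.map V (id : G → G)) := hV.prodMap measurable_id
  have hrect : ∀ A B, MeasurableSet A → MeasurableSet B →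
      R.map (fun ω => (V ω, X ω)) (A ×ˢ B) = κ.map (Prod.map V id) (A ×ˢ B) := by
    intro A B hA hB
    rw [Measure.map_apply hVX (hA.prod hB), Measure.map_apply hVid (hA.prod hB)]
    exact h A B hA hB
  refine Measure.ext_of_generateFrom_of_iUnion _
    (fun n => spanningSets (R.map V) n ×ˢ (univ : Set G)) generateFrom_prod.symm isPiSystem_prod
    ?_ (fun n => ?_) (fun n => ?_) ?_
  · rw [← iUnion_prod_const, iUnion_spanningSets, univ_prod_univ]
  · exact ⟨_, measurableSet_spanningSets _ n, univ, MeasurableSet.univ, rfl⟩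
  · have hS := measurableSet_spanningSets (R.map V) n
    rw [Measure.map_apply hVX (hS.prod MeasurableSet.univ)]
    have h2 := measure_spanningSets_lt_top (R.map V) n
    rw [Measure.map_apply hV hS] at h2
    exact ((measure_mono fun ω hω => hω.1).trans_lt h2).ne
  · rintro _ ⟨A, hA, B, hB, rfl⟩
    exact hrect A B hA hB

/-- If `V` and `X` are conditionally independent given `Z`, and if the joint law of `Z` and `X` is
equivalent to the product of the laws, then so is the joint law of `V` and `X`. Indeed, when `k` is
the density of the law of `(Z, X)`, the law of `(V, X)` is the image by `(ω, x) ↦ (V ω, x)` of the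
measure with the density `k (Z ω) x` with respect to `R ⊗ R_X`. -/
theorem CondIndepGiven.map_prodMk_equiv {V : Ω → E} {Z : Ω → F} {X : Ω → G}
    (hci : CondIndepGiven (MeasurableSpace.comap Z inferInstance) 𝒜 ℬ R)
    (h𝒜 : 𝒜 ≤ m0) (hℬ : ℬ ≤ m0) (hZ : Measurable[m0] Z)
    (hV : Measurable[𝒜] V) (hX : Measurable[ℬ] X) [SigmaFinite (R.trim hZ.comap_le)]
    [SigmaFinite (R.map V)] [SigmaFinite (R.map Z)] [SigmaFinite (R.map X)] [SigmaFinite R]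
    (h1 : R.map (fun ω => (Z ω, X ω)) ≪ (R.map Z).prod (R.map X))
    (h2 : (R.map Z).prod (R.map X) ≪ R.map (fun ω => (Z ω, X ω))) :
    R.map (fun ω => (V ω, X ω)) ≪ (R.map V).prod (R.map X) ∧
      (R.map V).prod (R.map X) ≪ R.map (fun ω => (V ω, X ω)) := by
  have hV0 : Measurable[m0] V := hV.mono h𝒜 le_rfl
  have hX0 : Measurable[m0] X := hX.mono hℬ le_rfl
  have hZX : Measurable fun ω => (Z ω, X ω) := hZ.prodMk hX0
  have hVX : Measurable fun ω => (V ω, X ω) := hV0.prodMk hX0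
  have hσ : SigmaFinite (R.map fun ω => (Z ω, X ω)) := by
    refine SigmaFinite.of_map _ measurable_fst.aemeasurable ?_
    rw [Measure.map_map measurable_fst hZX]
    assumption
  let k := (R.map fun ω => (Z ω, X ω)).rnDeriv ((R.map Z).prod (R.map X))
  have hk : Measurable k := Measure.measurable_rnDeriv _ _
  have hkR : ((R.map Z).prod (R.map X)).withDensity k = R.map fun ω => (Z ω, X ω) :=
    Measure.withDensity_rnDeriv_eq _ _ h1
  have hkpos : ∀ᵐ z ∂((R.map Z).prod (R.map X)), k z ≠ 0 :=
    (Measure.rnDeriv_pos' h2).mono fun z hz => hz.ne'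
  have hZid : Measurable (Prod.map Z (id : G → G)) := hZ.prodMap measurable_id
  have hVid : Measurable (Prod.map V (id : G → G)) := hV0.prodMap measurable_id
  have hmapZ : (R.prod (R.map X)).map (Prod.map Z id) = (R.map Z).prod (R.map X) := by
    rw [← Measure.map_prod_map _ _ hZ measurable_id, Measure.map_id]
  have hmapV : (R.prod (R.map X)).map (Prod.map V id) = (R.map V).prod (R.map X) := by
    rw [← Measure.map_prod_map _ _ hV0 measurable_id, Measure.map_id]
  let K : Ω × G → ℝ≥0∞ := fun z => k (Z z.1, z.2)
  have hK : Measurable K := hk.comp hZid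
  have hKpos : ∀ᵐ z ∂(R.prod (R.map X)), K z ≠ 0 := by
    rw [← hmapZ] at hkpos
    exact ae_of_ae_map hZid.aemeasurable hkpos
  let κ := (R.prod (R.map X)).withDensity K
  have hrect : ∀ A B, MeasurableSet A → MeasurableSet B →
      R (V ⁻¹' A ∩ X ⁻¹' B) = κ ((V ⁻¹' A) ×ˢ B) := by
    intro A B hA hB
    let f : Ω → ℝ≥0∞ := (V ⁻¹' A).indicator 1
    let g : G → ℝ≥0∞ := B.indicator 1
    have hf : Measurable[𝒜] f := measurable_indicator_one (hV hA)
    have hf0 : Measurable[m0] f := hf.mono h𝒜 le_rfl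
    have hg : Measurable g := measurable_one.indicator hB
    have hfg : ∫⁻ ω, g (X ω) * f ω ∂ R = R (V ⁻¹' A ∩ X ⁻¹' B) := by
      rw [← lintegral_indicator_one ((hV0 hA).inter (hX0 hB))]
      refine lintegral_congr fun ω => ?_
      by_cases ha : V ω ∈ A <;> by_cases hb : X ω ∈ B <;> simp [f, g, ha, hb]
    obtain ⟨φ, hφ, hφZ⟩ :=
      (measurable_condLExp (MeasurableSpace.comap Z inferInstance) R f).exists_eq_measurable_comp
    have hgm : Measurable fun z : F × G => φ z.1 * g z.2 :=
      (hφ.comp measurable_fst).mul (hg.comp measurable_snd)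
    -- The projection `φ ∘ Z` of `f` is introduced to use the density `k`, and removed afterwards.
    calc R (V ⁻¹' A ∩ X ⁻¹' B) = ∫⁻ ω, g (X ω) * f ω ∂ R := hfg.symm
      _ = ∫⁻ ω, g (X ω) * condLExp (MeasurableSpace.comap Z inferInstance) R f ω ∂ R :=
          hci.symm.lintegral_mul hZ.comap_le hℬ h𝒜 (hg.comp hX) hf
      _ = ∫⁻ z, φ z.1 * g z.2 ∂(R.map fun ω => (Z ω, X ω)) := by
          rw [lintegral_map hgm hZX, hφZ]
          exact lintegral_congr fun ω => mul_comm _ _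
      _ = ∫⁻ z, k z * (φ z.1 * g z.2) ∂((R.map Z).prod (R.map X)) := by
          rw [← hkR, lintegral_withDensity_eq_lintegral_mul _ hk hgm]; rfl
      _ = ∫⁻ z, K z * (φ (Z z.1) * g z.2) ∂(R.prod (R.map X)) := by
          have hm : Measurable fun z : F × G => k z * (φ z.1 * g z.2) := hk.mul hgm
          rw [← hmapZ, lintegral_map hm hZid]; rfl
      _ = ∫⁻ x, ∫⁻ ω, (g x * k (Z ω, x)) *
            condLExp (MeasurableSpace.comap Z inferInstance) R f ω ∂ R ∂(R.map X) := by
          have hm : Measurable fun z : Ω × G => K z * (φ (Z z.1) * g z.2) :=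
            hK.mul (hgm.comp hZid)
          rw [lintegral_prod_symm' _ hm, hφZ]
          refine lintegral_congr fun x => lintegral_congr fun ω => ?_
          simp only [K, Function.comp_apply]
          ring
      _ = ∫⁻ x, ∫⁻ ω, (g x * k (Z ω, x)) * f ω ∂ R ∂(R.map X) := by
          refine lintegral_congr fun x => ?_
          refine lintegral_mul_condLExp hZ.comap_le ?_ hf0
          exact ((hk.comp measurable_prodMk_right).comp (comap_measurable Z)).const_mul _
      _ = ∫⁻ z, (f z.1 * g z.2) * K z ∂(R.prod (R.map X)) := by
          have hm : Measurable fun z : Ω × G => (f z.1 * g z.2) * K z :=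
            ((hf0.comp measurable_fst).mul (hg.comp measurable_snd)).mul hK
          rw [lintegral_prod_symm' _ hm]
          refine lintegral_congr fun x => lintegral_congr fun ω => ?_
          simp only [K]
          ring
      _ = κ ((V ⁻¹' A) ×ˢ B) := by
          have hS : MeasurableSet ((V ⁻¹' A) ×ˢ B) := (hV0 hA).prod hB
          rw [withDensity_apply _ hS, ← lintegral_indicator hS]
          refine lintegral_congr fun z => ?_
          by_cases ha : V z.1 ∈ A <;> by_cases hb : z.2 ∈ B <;>
            simp [f, g, indicator, ha, hb]
  have hlaw := map_prodMk_eq_of_rect hV0 hX0 hrect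
  rw [hlaw, ← hmapV]
  exact ⟨(withDensity_absolutelyContinuous _ _).map hVid,
    (withDensity_absolutelyContinuous' hK.aemeasurable hKpos).map hVid⟩

end CondIndepProd

section Irreducible

variable {𝓧 : Type*} [TopologicalSpace 𝓧] [MeasurableSpace 𝓧]

theorem pathSigma_pair (s u : I) : (pathSigma {s, u} : MeasurableSpace C(I, 𝓧))
    = MeasurableSpace.comap (fun ω => (ω s, ω u)) inferInstance := by
  rw [pathSigma, iSup_insert, iSup_singleton]
  exact (MeasurableSpace.comap_prodMk _ _).symm

variable [MeasurableSpace C(I, 𝓧)] {R : Measure C(I, 𝓧)}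

theorem IsConditionable.sigmaFinite_map (hR : IsConditionable R) {E : Type*} [MeasurableSpace E]
    {V : C(I, 𝓧) → E} (hV : Measurable V) {p : E → 𝓧} (hp : Measurable p) {t : I}
    (h : ∀ ω, p (V ω) = ω t) : SigmaFinite (R.map V) := by
  refine SigmaFinite.of_map _ hp.aemeasurable ?_
  rw [Measure.map_map hp hV]
  have : p ∘ V = fun ω => ω t := funext h
  rw [this]
  exact hR t

variable [BorelSpace 𝓧] [BorelSpace C(I, 𝓧)]

/-- Irreducibility in the form used for reciprocal measures: the state at `t` is compared with the
pair of states at `s` and `u`. -/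
theorem IsIrreducible.map_equiv (hR : IsConditionable R) (hirr : IsIrreducible R) {s t u : I}
    (hst : s < t) (htu : t < u) :
    R.map (fun ω => ((ω s, ω u), ω t)) ≪ (R.map fun ω => (ω s, ω u)).prod (law R t) ∧
      (R.map fun ω => (ω s, ω u)).prod (law R t) ≪ R.map (fun ω => ((ω s, ω u), ω t)) := by
  have := hR s
  have := hR t
  have := hR u
  have ms := measurable_eval (𝓧 := 𝓧) s
  have mt := measurable_eval (𝓧 := 𝓧) t
  have mu := measurable_eval (𝓧 := 𝓧) u
  have msu : Measurable fun ω : C(I, 𝓧) => (ω s, ω u) := ms.prodMk mu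
  have hσ : SigmaFinite (R.map fun ω : C(I, 𝓧) => (ω s, ω u)) :=
    hR.sigmaFinite_map msu measurable_fst fun _ => rfl
  have mstu : Measurable fun ω : C(I, 𝓧) => (ω s, ω t, ω u) := ms.prodMk (mt.prodMk mu)
  let j : 𝓧 × 𝓧 × 𝓧 → (𝓧 × 𝓧) × 𝓧 := fun z => ((z.1, z.2.2), z.2.1)
  have hj : Measurable j :=
    (measurable_fst.prodMk measurable_snd.snd).prodMk measurable_snd.fst
  have hjR : (law₃ R s t u).map j = R.map fun ω => ((ω s, ω u), ω t) := by
    rw [law₃, Measure.map_map hj mstu]; rfl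
  have hjp : ((law R s).prod ((law R t).prod (law R u))).map j
      = ((law R s).prod (law R u)).prod (law R t) := by
    have h1 : MeasurePreserving (Prod.map id Prod.swap) ((law R s).prod ((law R t).prod (law R u)))
        ((law R s).prod ((law R u).prod (law R t))) :=
      (MeasurePreserving.id _).prod Measure.measurePreserving_swap
    have h2 := (measurePreserving_prodAssoc (law R s) (law R u) (law R t)).symm
    exact (h2.comp h1).map_eq
  obtain ⟨ha, hb⟩ := hirr s t u hst htu
  have ha' := ha.map hj
  have hb' := hb.map hj
  rw [hjR, hjp] at ha' hb'
  have hfst : (R.map fun ω => ((ω s, ω u), ω t)).map Prod.fst = R.map fun ω => (ω s, ω u) := by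
    rw [Measure.map_map measurable_fst (msu.prodMk mt)]; rfl
  have hc : (R.map fun ω => (ω s, ω u)) ≪ (law R s).prod (law R u) := by
    rw [← hfst]
    exact (hb'.map measurable_fst).trans Measure.quasiMeasurePreserving_fst.absolutelyContinuous
  have hd : (law R s).prod (law R u) ≪ R.map fun ω => (ω s, ω u) := by
    by_cases h0 : law R t univ = 0
    · have hR0 : R = 0 := by
        rw [law, Measure.map_apply mt MeasurableSet.univ, preimage_univ] at h0
        exact Measure.measure_univ_eq_zero.1 h0
      simp [law, hR0]
    · have h3 := ha'.map measurable_fst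
      rw [hfst, Measure.map_fst_prod] at h3
      exact (Measure.absolutelyContinuous_smul h0).trans h3
  exact ⟨hb'.trans (hd.prod Measure.AbsolutelyContinuous.rfl),
    (hc.prod Measure.AbsolutelyContinuous.rfl).trans ha'⟩

/-- Under an irreducible reciprocal measure, the state at an interior time is, up to equivalence of
measures, independent of any variable that does not look at the path near that time. -/
theorem IsIrreducible.map_prodMk_equiv (hR : IsReciprocal R) (hirr : IsIrreducible R)
    {E : Type*} [MeasurableSpace E] {V : C(I, 𝓧) → E} {s t u : I} (hs : 0 < s) (hst : s < t)
    (htu : t < u) (hu : u < 1) (hV : Measurable[pathSigma (Iic s ∪ Ici u)] V)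
    [SigmaFinite (R.map V)] :
    R.map (fun ω => (V ω, ω t)) ≪ (R.map V).prod (law R t) ∧
      (R.map V).prod (law R t) ≪ R.map (fun ω => (V ω, ω t)) := by
  have hZ : Measurable fun ω : C(I, 𝓧) => (ω s, ω u) :=
    (measurable_eval s).prodMk (measurable_eval u)
  have hci : CondIndepGiven (MeasurableSpace.comap (fun ω : C(I, 𝓧) => (ω s, ω u)) inferInstance)
      (pathSigma (Iic s ∪ Ici u)) (pathSigma (Icc s u)) R := by
    rw [← pathSigma_pair]
    exact fun A B hA hB => hR.2 s u hs (hst.trans htu) hu A B hA hB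
  have hσ : SigmaFinite (R.map fun ω : C(I, 𝓧) => (ω s, ω u)) :=
    hR.1.sigmaFinite_map hZ measurable_fst fun _ => rfl
  have htrim : SigmaFinite (R.trim hZ.comap_le) := by
    have := hR.1.sigmaFinite_trim (S := {s, u}) ⟨s, by simp⟩
    exact sigmaFinite_trim_congr (pathSigma_pair s u) (pathSigma_le _) _
  have := hR.1.sigmaFinite
  have : SigmaFinite (R.map fun ω : C(I, 𝓧) => ω t) := hR.1 t
  obtain ⟨h1, h2⟩ := hirr.map_equiv hR.1 hst htu
  exact hci.map_prodMk_equiv (pathSigma_le _) (pathSigma_le _) hZ hV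
    (measurable_eval_pathSigma ⟨hst.le, htu.le⟩) h1 h2

end Irreducible

/-! ### The density of a solution -/

section Pushforward

variable {Ω F : Type*} [MeasurableSpace F] {m0 : MeasurableSpace Ω} {R : Measure[m0] Ω}

theorem map_withDensity_comp {Y : Ω → F} (hY : Measurable Y) {q : F → ℝ≥0∞} (hq : Measurable q) :
    (R.withDensity fun ω => q (Y ω)).map Y = (R.map Y).withDensity q := by
  ext s hs
  rw [Measure.map_apply hY hs, withDensity_apply _ (hY hs), withDensity_apply _ hs,
    setLIntegral_map hs hq hY]

theorem withDensity_ofReal_comp_map {ρ : Ω → ℝ} {Y : Ω → F} (hY : Measurable Y) {r : F → ℝ}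
    (hr : Measurable r) (hρr : ρ =ᵐ[R] fun ω => r (Y ω)) :
    (R.withDensity fun ω => ENNReal.ofReal (ρ ω)).map Y
      = (R.map Y).withDensity fun y => ENNReal.ofReal (r y) := by
  rw [← map_withDensity_comp hY hr.ennreal_ofReal, withDensity_congr_ae]
  filter_upwards [hρr] with ω hω
  rw [hω]

/-- A density of minimal entropy that is a function of `Y` is a density of minimal entropy for the
problem on the image space, when the constraints only concern the law of `Y`. -/
theorem IsMinDensity.map {C : Measure[m0] Ω → Prop} {ρ : Ω → ℝ} (h : IsMinDensity R C ρ)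
    {Y : Ω → F} (hY : Measurable Y) {r : F → ℝ} (hr : Measurable r) (hr0 : ∀ y, 0 ≤ r y)
    (hρr : ρ =ᵐ[R] fun ω => r (Y ω)) {C' : Measure F → Prop}
    (hC : ∀ Q : Measure[m0] Ω, C' (Q.map Y) → C Q) : IsMinDensity (R.map Y) C' r := by
  have hml : ∀ {q : F → ℝ}, Measurable q → Measurable fun y => q y * Real.log (q y) :=
    fun hq => hq.mul (Real.measurable_log.comp hq)
  have hcongr : (fun ω => ρ ω * Real.log (ρ ω)) =ᵐ[R] fun ω => r (Y ω) * Real.log (r (Y ω)) := by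
    filter_upwards [hρr] with ω hω
    rw [hω]
  have hint : Integrable (fun ω => r (Y ω) * Real.log (r (Y ω))) R :=
    h.integrable_mul_log.congr hcongr
  refine ⟨hr, hr0, ?_, ?_, fun q hq hq0 hq1 hqi hqC => ?_⟩
  · rw [lintegral_map hr.ennreal_ofReal hY, ← h.lintegral_eq_one]
    refine lintegral_congr_ae ?_
    filter_upwards [hρr] with ω hω
    rw [hω]
  · exact (integrable_map_measure (hml hr).aestronglyMeasurable hY.aemeasurable).2 hint
  · rw [integral_map hY.aemeasurable (hml hr).aestronglyMeasurable,
      integral_map hY.aemeasurable (hml hq).aestronglyMeasurable, ← integral_congr_ae hcongr]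
    refine h.integral_le (fun ω => q (Y ω)) (hq.comp hY) (fun ω => hq0 _) ?_ ?_ (hC _ ?_)
    · rw [← hq1, lintegral_map hq.ennreal_ofReal hY]
    · exact (integrable_map_measure (hml hq).aestronglyMeasurable hY.aemeasurable).1 hqi
    · rwa [map_withDensity_comp hY hq.ennreal_ofReal]

/-- If the constraints only concern the law of `Y`, then a density of minimal entropy is a function
of `Y`. -/
theorem IsMinDensity.exists_eq_comp {C : Measure[m0] Ω → Prop} {ρ : Ω → ℝ}
    (h : IsMinDensity R C ρ) {Y : Ω → F} (hY : Measurable Y) [hσ : SigmaFinite (R.trim hY.comap_le)]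
    (hC : ∀ Q : Measure[m0] Ω, (∀ A, MeasurableSet[MeasurableSpace.comap Y inferInstance] A →
      Q A = (R.withDensity fun ω => ENNReal.ofReal (ρ ω)) A) → C Q) :
    ∃ r : F → ℝ, Measurable r ∧ (∀ y, 0 ≤ r y) ∧ ρ =ᵐ[R] fun ω => r (Y ω) := by
  have key := h.eq_mul_div (condIndepGiven_self hY.comap_le) le_rfl le_rfl hY.comap_le hY.comap_le
    fun Q hA _ => hC Q hA
  obtain ⟨c, hc, hcY⟩ := (measurable_condLExp (MeasurableSpace.comap Y inferInstance) R
    fun ω => ENNReal.ofReal (ρ ω)).exists_eq_measurable_comp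
  -- The product formula for `𝒜 = ℬ = 𝒢 = σ(Y)`.
  refine ⟨fun y => (c y * c y * (c y)⁻¹).toReal, ((hc.mul hc).mul hc.inv).ennreal_toReal,
    fun y => ENNReal.toReal_nonneg, ?_⟩
  filter_upwards [key] with ω hω
  rw [hcY] at hω
  simp only [Function.comp_apply] at hω
  rw [← hω, ENNReal.toReal_ofReal (h.nonneg ω)]

end Pushforward

section ConstraintMap

variable {𝓧 : Type*} [TopologicalSpace 𝓧]

/-- The data of a path on which the constraints bear: the pair of endpoints, followed by the states
at the times `e i`. The latter are doubled, so that all entries are in the same space. -/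
def constraintMap {n : ℕ} (e : Fin n → I) (ω : C(I, 𝓧)) : Fin (n + 1) → 𝓧 × 𝓧 :=
  Fin.cons (ω 0, ω 1) fun i => (ω (e i), ω (e i))

theorem constraintMap_castSucc {n : ℕ} (e : Fin (n + 1) → I) (ω : C(I, 𝓧)) (i : Fin (n + 1)) :
    constraintMap e ω i.castSucc = constraintMap (fun j => e j.castSucc) ω i := by
  refine Fin.cases ?_ (fun j => ?_) i
  · rfl
  · rw [← Fin.succ_castSucc]; rfl

theorem constraintMap_last {n : ℕ} (e : Fin (n + 1) → I) (ω : C(I, 𝓧)) :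
    constraintMap e ω (Fin.last (n + 1)) = (ω (e (Fin.last n)), ω (e (Fin.last n))) := by
  rw [← Fin.succ_last]; rfl

variable [MeasurableSpace 𝓧]

theorem measurable_constraintMap_pathSigma {n : ℕ} (e : Fin n → I) {S : Set I} (h0 : 0 ∈ S)
    (h1 : 1 ∈ S) (he : ∀ i, e i ∈ S) :
    Measurable[pathSigma S] (constraintMap e : C(I, 𝓧) → Fin (n + 1) → 𝓧 × 𝓧) := by
  refine @measurable_pi_lambda _ _ _ (pathSigma S) _ _ fun i => ?_
  refine Fin.cases ?_ (fun j => ?_) i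
  · exact Measurable.prodMk (measurable_eval_pathSigma (𝓧 := 𝓧) h0)
      (measurable_eval_pathSigma h1)
  · exact Measurable.prodMk (measurable_eval_pathSigma (𝓧 := 𝓧) (he j))
      (measurable_eval_pathSigma (he j))

variable [BorelSpace 𝓧] [MeasurableSpace C(I, 𝓧)] [BorelSpace C(I, 𝓧)] {R P : Measure C(I, 𝓧)}

theorem measurable_constraintMap {n : ℕ} (e : Fin n → I) :
    Measurable (constraintMap e : C(I, 𝓧) → Fin (n + 1) → 𝓧 × 𝓧) :=
  (measurable_constraintMap_pathSigma e (mem_univ 0) (mem_univ 1) fun _ => mem_univ _).mono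
    (pathSigma_le univ) le_rfl

theorem IsConditionable.sigmaFinite_map_constraintMap (hR : IsConditionable R) {n : ℕ}
    (e : Fin n → I) : SigmaFinite (R.map (constraintMap e)) :=
  hR.sigmaFinite_map (measurable_constraintMap e)
    (measurable_fst.comp (measurable_pi_apply 0)) (t := 0) fun _ => rfl

theorem measurable_constraintMap_apply {n : ℕ} (e : Fin n → I) (i : Fin (n + 1)) :
    Measurable fun ω : C(I, 𝓧) => constraintMap e ω i :=
  (measurable_pi_apply i).comp (measurable_constraintMap e)

theorem IsConditionable.sigmaFinite_map_constraintMap_apply (hR : IsConditionable R) {n : ℕ}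
    (e : Fin n → I) (i : Fin (n + 1)) : SigmaFinite (R.map fun ω => constraintMap e ω i) := by
  have hm := measurable_constraintMap_apply (𝓧 := 𝓧) e i
  revert hm
  refine Fin.cases (fun hm => ?_) (fun j hm => ?_) i
  · exact hR.sigmaFinite_map hm measurable_fst (t := 0) fun _ => rfl
  · exact hR.sigmaFinite_map hm measurable_fst (t := e j) fun _ => rfl

theorem sameConstraints_of_map_eq {n : ℕ} {e : Fin n → I} {𝒯 : Set I} {Q : Measure C(I, 𝓧)}
    (h𝒯 : ∀ t ∈ 𝒯, t = 0 ∨ t = 1 ∨ ∃ i, t = e i)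
    (h : ∀ i, Q.map (fun ω => constraintMap e ω i) = P.map fun ω => constraintMap e ω i) :
    SameConstraints 𝒯 P Q := by
  have key : ∀ (i : Fin (n + 1)) (p : 𝓧 × 𝓧 → 𝓧), Measurable p →
      Q.map (fun ω => p (constraintMap e ω i)) = P.map fun ω => p (constraintMap e ω i) := by
    intro i p hp
    have := congrArg (Measure.map p) (h i)
    rwa [Measure.map_map hp (measurable_constraintMap_apply e i),
      Measure.map_map hp (measurable_constraintMap_apply e i)] at this
  refine ⟨fun t ht => ?_, h 0⟩
  rcases h𝒯 t ht with rfl | rfl | ⟨i, rfl⟩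
  · exact key 0 Prod.fst measurable_fst
  · exact key 0 Prod.snd measurable_snd
  · exact key i.succ Prod.fst measurable_fst

/-- For an irreducible reciprocal measure, the joint law of the pair of endpoints and of the states
at finitely many interior times is equivalent to the product of the laws. -/
theorem IsIrreducible.map_constraintMap_equiv (hR : IsReciprocal R) (hirr : IsIrreducible R)
    {n : ℕ} (e : Fin n → I) (he : Function.Injective e) (he0 : ∀ i, 0 < e i) (he1 : ∀ i, e i < 1) :
    R.map (constraintMap e) ≪ Measure.pi (fun i => R.map fun ω => constraintMap e ω i) ∧
      Measure.pi (fun i => R.map fun ω => constraintMap e ω i) ≪ R.map (constraintMap e) := by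
  induction n with
  | zero =>
    have hσ := fun i => hR.1.sigmaFinite_map_constraintMap_apply e i
    have : Measure.pi (fun i => R.map fun ω => constraintMap e ω i) = R.map (constraintMap e) := by
      refine Measure.pi_eq fun s hs => ?_
      rw [Measure.map_apply (measurable_constraintMap e) (MeasurableSet.univ_pi hs),
        Fin.prod_univ_one, Measure.map_apply (measurable_constraintMap_apply e 0) (hs 0)]
      congr 1
      ext ω
      simp [Fin.forall_fin_one]
    rw [this]
    exact ⟨Measure.AbsolutelyContinuous.rfl, Measure.AbsolutelyContinuous.rfl⟩
  | succ n ih =>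
    let t := e (Fin.last n)
    let e' : Fin n → I := fun j => e j.castSucc
    obtain ⟨ih1, ih2⟩ := ih e' (he.comp (Fin.castSucc_injective n)) (fun i => he0 _) fun i => he1 _
    have hσ := fun i => hR.1.sigmaFinite_map_constraintMap_apply e i
    have hσ' := fun i => hR.1.sigmaFinite_map_constraintMap_apply e' i
    have hσY := hR.1.sigmaFinite_map_constraintMap e'
    have hσt : SigmaFinite (law R t) := hR.1 t
    -- The other times keep a distance from `t`.
    obtain ⟨s, u, hs, hst, htu, hu, hS⟩ : ∃ s u : I, 0 < s ∧ s < t ∧ t < u ∧ u < 1 ∧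
        ∀ i, e' i ∈ Iic s ∪ Ici u := by
      have hfin : (range e').Finite := finite_range e'
      have ht : t ∉ range e' := by
        rintro ⟨j, hj⟩
        exact (Fin.castSucc_lt_last j).ne (he hj)
      obtain ⟨l, v, ⟨hl, hv⟩, hlv⟩ := (mem_nhds_iff_exists_Ioo_subset' ⟨0, he0 _⟩ ⟨1, he1 _⟩).1
        (hfin.isClosed.isOpen_compl.mem_nhds ht)
      obtain ⟨s, hls, hst⟩ := exists_between hl
      obtain ⟨u, htu, huv⟩ := exists_between hv
      refine ⟨s, u, (unitInterval.nonneg' (t := l)).trans_lt hls, hst, htu,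
        huv.trans_le unitInterval.le_one', ?_⟩
      intro i
      by_contra hi
      simp only [mem_union, mem_Iic, mem_Ici, not_or, not_le] at hi
      exact hlv ⟨hls.trans hi.1, hi.2.trans huv⟩ ⟨i, rfl⟩
    have hVmeas : Measurable[pathSigma (Iic s ∪ Ici u)]
        (constraintMap e' : C(I, 𝓧) → Fin (n + 1) → 𝓧 × 𝓧) :=
      measurable_constraintMap_pathSigma e' (Or.inl hs.le) (Or.inr hu.le) hS
    obtain ⟨h1, h2⟩ := hirr.map_prodMk_equiv hR hs hst htu hu hVmeas
    let j := MeasurableEquiv.piFinSuccAbove (fun _ : Fin (n + 2) => 𝓧 × 𝓧) (Fin.last (n + 1))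
    let J : (Fin (n + 1) → 𝓧 × 𝓧) × 𝓧 → Fin (n + 2) → 𝓧 × 𝓧 := fun z => j.symm ((z.2, z.2), z.1)
    have hJ : Measurable J :=
      j.symm.measurable.comp ((measurable_snd.prodMk measurable_snd).prodMk measurable_fst)
    have hJR : (R.map fun ω => (constraintMap e' ω, ω t)).map J = R.map (constraintMap e) := by
      rw [Measure.map_map hJ ((measurable_constraintMap e').prodMk (measurable_eval t))]
      congr 1
      funext ω
      refine j.symm_apply_eq.2 ?_
      refine Prod.ext (constraintMap_last e ω).symm (funext fun i => ?_)
      change _ = constraintMap e ω ((Fin.last (n + 1)).succAbove i)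
      rw [Fin.succAbove_last]
      exact (constraintMap_castSucc e ω i).symm
    have hJp : ((Measure.pi fun i => R.map fun ω => constraintMap e' ω i).prod (law R t)).map J
        = Measure.pi fun i => R.map fun ω => constraintMap e ω i := by
      have hd : MeasurePreserving (fun x : 𝓧 => (x, x)) (law R t)
          (R.map fun ω => constraintMap e ω (Fin.last (n + 1))) := by
        have hm : Measurable fun x : 𝓧 => (x, x) := measurable_id.prodMk measurable_id
        refine ⟨hm, ?_⟩
        rw [law, Measure.map_map hm (measurable_eval t)]
        rfl
      have hp : (fun i : Fin (n + 1) =>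
          R.map fun ω => constraintMap e ω ((Fin.last (n + 1)).succAbove i))
            = fun i => R.map fun ω => constraintMap e' ω i := by
        funext i
        congr 1
        funext ω
        rw [Fin.succAbove_last]
        exact constraintMap_castSucc e ω i
      have h3 := (measurePreserving_piFinSuccAbove
        (fun i : Fin (n + 2) => R.map fun ω => constraintMap e ω i) (Fin.last (n + 1))).symm
      rw [hp] at h3
      exact (h3.comp ((hd.prod (MeasurePreserving.id _)).comp
        Measure.measurePreserving_swap)).map_eq
    rw [← hJR, ← hJp]
    exact ⟨(h1.trans (ih1.prod Measure.AbsolutelyContinuous.rfl)).map hJ,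
      ((ih2.prod Measure.AbsolutelyContinuous.rfl).trans h2).map hJ⟩

end ConstraintMap

section Product

variable {𝓧 : Type*} [TopologicalSpace 𝓧] [MeasurableSpace 𝓧] [BorelSpace 𝓧]
  [MeasurableSpace C(I, 𝓧)] [BorelSpace C(I, 𝓧)]
  {R P : Measure C(I, 𝓧)} {𝒯 : Set I} {μ : I → Measure 𝓧} {π : Measure (𝓧 × 𝓧)}

/-- The density of a solution is a product of functions of the pair of endpoints and of the states
at the constrained interior times. -/
theorem IsSolution.exists_rnDeriv_eq_prod (hR : IsReciprocal R) (hirr : IsIrreducible R)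
    (hP : IsSolution R 𝒯 μ π P) {n : ℕ} (e : Fin n → I) (he : Function.Injective e)
    (he0 : ∀ i, 0 < e i) (he1 : ∀ i, e i < 1) (h𝒯 : ∀ t ∈ 𝒯, t = 0 ∨ t = 1 ∨ ∃ i, t = e i) :
    ∃ g : Fin (n + 1) → 𝓧 × 𝓧 → ℝ≥0∞, (∀ i, Measurable (g i)) ∧ (∀ i z, g i z ≠ ∞) ∧
      P.rnDeriv R =ᵐ[R] fun ω => ∏ i, g i (constraintMap e ω i) := by
  have := hP.1.isProbabilityMeasure
  have := hR.1.sigmaFinite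
  have hY := measurable_constraintMap (𝓧 := 𝓧) e
  have hYi := measurable_constraintMap_apply (𝓧 := 𝓧) e
  have hσ := hR.1.sigmaFinite_map_constraintMap e
  have hproj : ∀ (Q : Measure C(I, 𝓧)) i,
      (Q.map (constraintMap e)).map (fun x => x i) = Q.map fun ω => constraintMap e ω i :=
    fun Q i => Measure.map_map (measurable_pi_apply i) hY
  have hσi : ∀ i, SigmaFinite ((R.map (constraintMap e)).map fun x => x i) := fun i => by
    rw [hproj]; exact hR.1.sigmaFinite_map_constraintMap_apply e i
  have htrim : SigmaFinite (R.trim hY.comap_le) := by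
    refine @SigmaFinite.of_map _ _ (MeasurableSpace.comap _ _) _ _ _
      (comap_measurable (constraintMap e)).aemeasurable ?_
    rwa [map_trim_comap hY]
  have hmin := hP.isMinDensity
  have hwd := hP.withDensity_toReal_rnDeriv
  obtain ⟨r, hr, hr0, hρr⟩ := hmin.exists_eq_comp hY fun Q hQ => by
    rw [hwd] at hQ
    refine sameConstraints_of_map_eq h𝒯 fun i => map_eq_of_forall_eq hY.comap_le hQ ?_
    exact (measurable_pi_apply i).comp (comap_measurable (constraintMap e))
  have hPY : P.map (constraintMap e)
      = (R.map (constraintMap e)).withDensity fun y => ENNReal.ofReal (r y) := by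
    rw [← withDensity_ofReal_comp_map hY hr hρr, hwd]
  have hmin' := hmin.map hY hr hr0 hρr
    (C' := fun Q => ∀ i, Q.map (fun x => x i) = (P.map (constraintMap e)).map fun x => x i)
    fun Q hQ => sameConstraints_of_map_eq h𝒯 fun i => by rw [← hproj, hQ i, hproj]
  obtain ⟨h1, h2⟩ := hirr.map_constraintMap_equiv hR e he he0 he1
  have hmarg : (fun i => (R.map (constraintMap e)).map fun x => x i)
      = fun i => R.map fun ω => constraintMap e ω i := funext fun i => hproj R i
  obtain ⟨g, hg, hg', hrg⟩ := hmin'.exists_eq_prod (fun Q hQ i => by rw [hQ i, hPY])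
    (hmarg ▸ h1) (hmarg ▸ h2)
  refine ⟨g, hg, hg', ?_⟩
  filter_upwards [hρr, ae_of_ae_map hY.aemeasurable hrg, Measure.rnDeriv_ne_top P R]
    with ω ha hb hc
  rw [← hb, ← ha, ENNReal.ofReal_toReal hc]

theorem ennreal_log_prod {ι : Type*} (s : Finset ι) (f : ι → ℝ≥0∞) :
    ENNReal.log (∏ i ∈ s, f i) = ∑ i ∈ s, ENNReal.log (f i) := by
  induction s using Finset.cons_induction with
  | empty => simp
  | cons a s ha ih => rw [Finset.prod_cons, Finset.sum_cons, ENNReal.log_mul_add, ih]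

/-- The constrained times may be listed with repetitions, and may contain the endpoints: the factor
of an interior time is attributed to one of the indices of this time, and the endpoints are taken
into account by `η`. -/
theorem IsSolution.exists_rnDeriv_eq_exp (hR : IsReciprocal R) (hirr : IsIrreducible R)
    {K : ℕ} (t : Fin K → I) (hP : IsSolution R (range t) μ π P) :
    ∃ (η : 𝓧 × 𝓧 → EReal) (f : Fin K → 𝓧 → EReal), Measurable η ∧ (∀ z, η z ≠ ⊤) ∧
      (∀ i, Measurable (f i)) ∧ (∀ i x, f i x ≠ ⊤) ∧
      P.rnDeriv R =ᵐ[R] fun ω => EReal.exp (η (ω 0, ω 1) + ∑ i, f i (ω (t i))) := by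
  obtain ⟨n, e, he, heT⟩ : ∃ (n : ℕ) (e : Fin n → I), Function.Injective e ∧
      range e = range t \ {0, 1} := by
    have hfin : (range t \ {0, 1}).Finite := (finite_range t).subset sdiff_subset
    have := hfin.fintype
    refine ⟨_, fun i => ((Fintype.equivFin ↥(range t \ {0, 1})).symm i : I),
      Subtype.val_injective.comp (Equiv.injective _), ?_⟩
    change range (Subtype.val ∘ _) = _
    rw [(Equiv.surjective _).range_comp, Subtype.range_coe]
  have hmem : ∀ i, e i ∈ range t \ {0, 1} := fun i => heT ▸ mem_range_self i
  have he0 : ∀ i, 0 < e i := fun i =>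
    unitInterval.nonneg'.lt_of_ne fun h => (hmem i).2 (Or.inl h.symm)
  have he1 : ∀ i, e i < 1 := fun i =>
    unitInterval.le_one'.lt_of_ne fun h => (hmem i).2 (Or.inr h)
  obtain ⟨g, hg, hg', hgR⟩ := hP.exists_rnDeriv_eq_prod hR hirr e he he0 he1 fun s hs => by
    by_cases h0 : s = 0
    · exact Or.inl h0
    by_cases h1 : s = 1
    · exact Or.inr (Or.inl h1)
    have : s ∈ range e := heT ▸ ⟨hs, by simp [h0, h1]⟩
    obtain ⟨i, hi⟩ := this
    exact Or.inr (Or.inr ⟨i, hi.symm⟩)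
  choose r hr using fun i => (hmem i).1
  have hdiag : Measurable fun x : 𝓧 => (x, x) := measurable_id.prodMk measurable_id
  let G : Fin K → 𝓧 → ℝ≥0∞ := fun k x => ∏ i, if r i = k then g i.succ (x, x) else 1
  have hG : ∀ k, Measurable (G k) := fun k => Finset.measurable_prod _ fun i _ => by
    split_ifs
    · exact (hg _).comp hdiag
    · exact measurable_const
  have hG' : ∀ k x, G k x ≠ ∞ := fun k x => ENNReal.prod_ne_top fun i _ => by
    split_ifs
    · exact hg' _ _
    · exact ENNReal.one_ne_top
  refine ⟨fun z => ENNReal.log (g 0 z), fun k x => ENNReal.log (G k x), (hg 0).ennreal_log,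
    fun z => by simpa using hg' 0 z, fun k => (hG k).ennreal_log, fun k x => by simpa using hG' k x,
    ?_⟩
  filter_upwards [hgR] with ω hω
  have hprod : ∏ k, G k (ω (t k)) = ∏ i, g (Fin.succ i) (ω (e i), ω (e i)) := by
    simp only [G]
    rw [Finset.prod_comm]
    refine Finset.prod_congr rfl fun i _ => ?_
    rw [Finset.prod_ite_eq Finset.univ (r i), if_pos (Finset.mem_univ _), hr i]
  rw [← ennreal_log_prod, hprod, ← ENNReal.log_mul_add, ENNReal.exp_log, hω, Fin.prod_univ_succ]
  rfl

end Product

end Brodinger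

theorem mainTheorem3 {𝓧 : Type*} [TopologicalSpace 𝓧] [PolishSpace 𝓧]
    [MeasurableSpace 𝓧] [BorelSpace 𝓧]
    [MeasurableSpace C(I, 𝓧)] [BorelSpace C(I, 𝓧)]
    (R : Measure C(I, 𝓧)) (𝒯 : Set I) (μ : I → Measure 𝓧) (π : Measure (𝓧 × 𝓧))
    (P : Measure C(I, 𝓧))
    (hR : Brodinger.IsReciprocal R)
    (hP : Brodinger.IsSolution R 𝒯 μ π P) :
    Brodinger.IsReciprocal P ∧
      (Brodinger.IsIrreducible R →
        ∀ (K : ℕ) (t : Fin K → I), 𝒯 = Set.range t →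
          ∃ (η : 𝓧 × 𝓧 → EReal) (f : Fin K → 𝓧 → EReal),
            Measurable η ∧ (∀ z, η z ≠ ⊤) ∧
            (∀ i, Measurable (f i)) ∧ (∀ i x, f i x ≠ ⊤) ∧
            P ≪ R ∧
            P.rnDeriv R =ᵐ[R]
              fun ω => EReal.exp (η (ω 0, ω 1) + ∑ i, f i (ω (t i)))) := by
  refine ⟨hP.isReciprocal hR, fun hirr K t ht => ?_⟩
  subst ht
  have := hR.1.sigmaFinite
  obtain ⟨η, f, h1, h2, h3, h4, h5⟩ := hP.exists_rnDeriv_eq_exp hR hirr t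
  exact ⟨η, f, h1, h2, h3, h4, hP.absolutelyContinuous, h5⟩
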